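/- \textbf{Setting.} $\mathcal K_\infty$ is the class of continuous, strictly increasing, unbounded $\alpha:\mathbb R_{\ge0}\to\mathbb R_{\ge0}$ with $\alpha(0)=0$; $\beta\in\mathcal{KL}$ means that $\beta(\cdot,s)\in\mathcal K_\infty$ for each $s\ge0$ and that $\beta(r,\cdot)$ decreases monotonically to $0$ for each $r\ge0$. A function $f:\mathbb R_{\ge0}\to\mathbb R_{\ge0}$ is positive definite if $f(0)=0$ and $f(r)>0$ for $r>0$. A function $F(t,\xi)$ on $\mathbb R_{\ge 0}\times S$ is Carathéodory if it is measurable in $t$, continuous in $\xi$, and for each compact $K\subset\mathbb R_{\ge0}\times S$ there is an integrable $m_K$ with $|F(t,\xi)|\le m_K(t)$ on $K$. An impulse-time sequence is a strictly increasing $\gamma=\{\tau_k\}_{k=1}^N\subset(0,\infty)$, $N$ finite or infinite, with no finite limit point; put $\tau_0=0$ and, if $N<\infty$, $\tau_{N+1}=\infty$. It has minimum dwell time $\theta$ if $\tau_{k+1}-\tau_k\ge\theta$ for all $0\le k<N$, and maximum dwell time $\theta$ if $N=\infty$ and $\tau_{k+1}-\tau_k\le\theta$ for all $k\ge0$. Inputs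 are Lebesgue measurable, locally essentially bounded $u:[0,\infty)\to\mathbb R^m$. An impulsive system $\Sigma=(\gamma,f,g)$ is given by $\gamma$ and maps $f,g:\mathbb R_{\ge0}\times\mathbb R^n\times\mathbb R^m\to\mathbb R^n$ such that $(t,\xi)\mapsto f(t,\xi,u(t))$ is Carathéodory for every input $u$. A solution with data $t_0\ge0$, $x_0$, $u$ is a function $x:[t_0,T_x)\to\mathbb R^n$ ($t_0<T_x\le\infty$) with $x(t_0)=x_0$ that, on each $[t_1,t_2)\subset[t_0,T_x)$ without points of $\gamma$ in its interior, is locally absolutely continuous with $\dot x(t)=f(t,x(t),u(t))$ for almost all $t$, and such that for each $t\in\gamma\cap(t_0,T_x)$ the finite left limit $x(t^-)$ exists and $x(t)=x(t^-)+g(t,x(t^-),u(t))$. It is maximally defined if it has no extension to a solution on a longer interval. Let $n^\gamma_{(a,b]}=\#(\gamma\cap(a,b])$ and $\|u_I\|_\gamma=\max\{\operatorname{ess\,sup}_{t\in I}|u(t)|,\ \sup_{t\in\gamma\cap I}|u(t)|\}$. Let $h^o,h:\mathbb R_{\ge0}\times\mathbb R^n\to\mathbb R_{\ge0}$ and let $\{\Sigma_\lambda=(\gamma_\lambda,f_\lambda,g_\lambda)\}_{\lambda\in\Lambda}$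 be a family of impulsive systems. The family is strongly $(h^o,h)$-ISS if there are $\beta\in\mathcal{KL}$ and $\rho\in\mathcal K_\infty$ such that for all $\lambda\in\Lambda$, $t_0\ge0$, $x_0\in\mathbb R^n$, all inputs $u$, all maximally defined solutions $x$ of $\Sigma_\lambda$ with these data and all $t\in[t_0,T_x)$, $$h(t,x(t))\le\beta\big(h^o(t_0,x_0),\,t-t_0+n^{\gamma_\lambda}_{(t_0,t]}\big)+\rho\big(\|u_{(t_0,t]}\|_{\gamma_\lambda}\big).$$ \textbf{Assumption 1} for given Carathéodory functions $\varphi_\lambda:\mathbb R_{\ge0}\times\mathbb R_{\ge0}\to\mathbb R$ and functions $\alpha_\lambda:\mathbb R_{\ge0}\times\mathbb R_{\ge0}\to\mathbb R_{\ge0}$: there are functions $V_\lambda:\mathbb R_{\ge0}\times\mathbb R^n\to\mathbb R$, locally Lipschitz on $[\tau_k,\tau_{k+1})\times\mathbb R^n$ for all $0\le k<N+1$ (with $\{\tau_k\}_{k=1}^N=\gamma_\lambda$) and such that, for $\tau\in\gamma_\lambda$ and $\xi\in\mathbb R^n$, the finite limit $V_\lambda(\tau^-,\xi):=\lim_{t\to\tau^-}V_\lambda(t,\xi)$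 exists and equals $\lim_{(t,\zeta)\to(\tau^-,\xi)}V_\lambda(t,\zeta)$; there are $\phi_1,\phi_2\in\mathcal K_\infty$ with $\phi_1(h(t,\xi))\le V_\lambda(t,\xi)\le\phi_2(h^o(t,\xi))$ for all $\lambda,t,\xi$; and there are $\chi,\pi\in\mathcal K_\infty$ such that for all $\lambda\in\Lambda$, $t\ge0$, $\xi\in\mathbb R^n$, $\mu\in\mathbb R^m$: (i) if $t\notin\gamma_\lambda$ and $V_\lambda(t,\xi)\ge\chi(|\mu|)$, then $$\limsup_{s\to0^+}\frac{V_\lambda(t+s,\xi+sf_\lambda(t,\xi,\mu))-V_\lambda(t,\xi)}{s}\le-\varphi_\lambda(t,V_\lambda(t,\xi));$$ (ii) if $t\in\gamma_\lambda$ and $V_\lambda(t^-,\xi)\ge\chi(|\mu|)$, then $V_\lambda(t,\xi+g_\lambda(t,\xi,\mu))\le\alpha_\lambda(t,V_\lambda(t^-,\xi))$; (iii) if $t\in\gamma_\lambda$ and $V_\lambda(t^-,\xi)\le\chi(|\mu|)$, then $V_\lambda(t,\xi+g_\lambda(t,\xi,\mu))\le\pi(|\mu|)$. \textbf{Theorem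 4.} Suppose that Assumption 1 holds with $\varphi_\lambda(t,r)=\phi(t)\bar\varphi(r)$ and $\alpha_\lambda(t,r)=\bar\alpha(r)$ for all $\lambda\in\Lambda$, where $\phi:\mathbb R_{\ge0}\to\mathbb R_{\ge0}$ is locally integrable, $\bar\varphi:\mathbb R_{\ge0}\to\mathbb R$ is continuous, and $\bar\alpha:\mathbb R_{\ge0}\to\mathbb R_{\ge0}$ is continuous and positive definite. Then $\{\Sigma_\lambda\}_{\lambda\in\Lambda}$ is strongly $(h^o,h)$-ISS if one of the following two conditions holds: (a) $\bar\varphi$ is positive definite and there is $\theta>0$ such that every $\gamma_\lambda$ has minimum dwell time $\theta$ and $$\sup_{a>0}\int_a^{\bar\alpha(a)}\frac{ds}{\bar\varphi(s)}<\inf_{t\ge0}\int_t^{t+\theta}\phi(s)\,ds=:M,\qquad M>0;$$ (b) $-\bar\varphi$ is positive definite and there is $\theta>0$ such that every $\gamma_\lambda$ has maximum dwell time $\theta$, $$\int_1^\infty\frac{ds}{-\bar\varphi(s)}=\infty\qquad\text{and}\qquad\inf_{a>0}\int_{\bar\alpha(a)}^a\frac{ds}{-\bar\varphi(s)}>\sup_{t\ge0}\int_t^{t+\theta}\phi(s)\,ds.$$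 -/

import Mathlib

open Set Filter Topology MeasureTheory
open scoped ENNReal

noncomputable section

/-! Conventions: functions on `ℝ≥0 = [0,∞)` are represented by functions on `ℝ` whose values are
only constrained on `Set.Ici 0`; `ℝⁿ` with the Euclidean norm is `EuclideanSpace ℝ (Fin n)`. -/

/-! ### Comparison functions -/

/-- Class `𝒦∞`: continuous, strictly increasing, vanishing at `0` and unbounded on `[0,∞)`. -/
def IsKInf (α : ℝ → ℝ) : Prop :=
  ContinuousOn α (Ici 0) ∧ StrictMonoOn α (Ici 0) ∧ α 0 = 0 ∧ ¬ BddAbove (α '' Ici 0)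

/-- Class `𝒦ℒ`: `β(·,s) ∈ 𝒦∞` for every `s ≥ 0`, and for every `r ≥ 0` the function `β(r,·)`
decreases monotonically to zero. -/
def IsKL (β : ℝ → ℝ → ℝ) : Prop :=
  (∀ s, 0 ≤ s → IsKInf fun r => β r s) ∧
  ∀ r, 0 ≤ r → AntitoneOn (β r) (Ici 0) ∧ Tendsto (β r) atTop (𝓝 0)

/-- Positive definite function `[0,∞) → [0,∞)`. -/
def IsPosDefFun (f : ℝ → ℝ) : Prop :=
  f 0 = 0 ∧ ∀ r, 0 < r → 0 < f r

/-- `F : [0,∞) × S → Y` is a Carathéodory function: measurable in `t`, continuous in `ξ`, and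
dominated on each compact set by an integrable function of `t`. -/
def IsCaratheodoryFun {X Y : Type*} [TopologicalSpace X] [NormedAddCommGroup Y]
    [MeasurableSpace Y] (S : Set X) (F : ℝ → X → Y) : Prop :=
  (∀ ξ ∈ S, AEMeasurable (fun t => F t ξ) (volume.restrict (Ici (0 : ℝ)))) ∧
  (∀ t, 0 ≤ t → ContinuousOn (F t) S) ∧
  ∀ K : Set (ℝ × X), IsCompact K → K ⊆ Ici 0 ×ˢ S →
    ∃ b : ℝ → ℝ, Integrable b volume ∧ ∀ p ∈ K, ‖F p.1 p.2‖ ≤ b p.1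

/-! ### Impulse-time sequences -/

/-- An impulse-time sequence `{τ_k}_{k=1}^N ⊂ (0,∞)`, `N` finite or infinite, strictly increasing
and without finite limit points, together with the convention `τ_0 = 0`. The values `τ k` for
`k > N` are irrelevant. -/
structure ImpulseSeq where
  N : ℕ∞
  τ : ℕ → ℝ
  τ_zero : τ 0 = 0
  τ_lt : ∀ k : ℕ, (k : ℕ∞) < N → τ k < τ (k + 1)
  τ_tendsto : N = ⊤ → Tendsto τ atTop atTop

namespace ImpulseSeq

/-- The set `{τ_k : 1 ≤ k < N + 1}` of impulse times. -/
def times (γ : ImpulseSeq) : Set ℝ :=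
  {t | ∃ k : ℕ, 1 ≤ k ∧ (k : ℕ∞) ≤ γ.N ∧ γ.τ k = t}

open Classical in
/-- `τ_{k+1}`, with the convention `τ_{N+1} = ∞` when `N` is finite. -/
def next (γ : ImpulseSeq) (k : ℕ) : EReal :=
  if (k : ℕ∞) < γ.N then ((γ.τ (k + 1) : ℝ) : EReal) else ⊤

/-- The number of impulse times in the interval `(a, b]`. -/
def count (γ : ImpulseSeq) (a b : ℝ) : ℕ := (γ.times ∩ Ioc a b).ncard

/-- Minimum dwell time `θ`. -/
def HasMinDwell (γ : ImpulseSeq) (θ : ℝ) : Prop :=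
  ∀ k : ℕ, (k : ℕ∞) < γ.N → θ ≤ γ.τ (k + 1) - γ.τ k

/-- Maximum dwell time `θ`. -/
def HasMaxDwell (γ : ImpulseSeq) (θ : ℝ) : Prop :=
  γ.N = ⊤ ∧ ∀ k : ℕ, γ.τ (k + 1) - γ.τ k ≤ θ

end ImpulseSeq

/-! ### Impulsive systems with inputs and their solutions -/

/-- Inputs: Lebesgue measurable, locally essentially bounded functions `[0,∞) → ℝᵐ`. -/
def IsInput {m : ℕ} (u : ℝ → EuclideanSpace ℝ (Fin m)) : Prop :=
  AEMeasurable u (volume.restrict (Ici 0)) ∧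
  ∀ T : ℝ, ∃ C : ℝ, ∀ᵐ t ∂(volume.restrict (Icc 0 T)), ‖u t‖ ≤ C

/-- An impulsive system `Σ = (γ, f, g)` with state space `ℝⁿ` and input space `ℝᵐ`; for every
input `u` the map `(t, ξ) ↦ f(t, ξ, u(t))` is a Carathéodory function. -/
structure ImpulsiveSystem (n m : ℕ) where
  γ : ImpulseSeq
  f : ℝ → EuclideanSpace ℝ (Fin n) → EuclideanSpace ℝ (Fin m) → EuclideanSpace ℝ (Fin n)
  g : ℝ → EuclideanSpace ℝ (Fin n) → EuclideanSpace ℝ (Fin m) → EuclideanSpace ℝ (Fin n)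
  caratheodory : ∀ u : ℝ → EuclideanSpace ℝ (Fin m), IsInput u →
    IsCaratheodoryFun univ fun t ξ => f t ξ (u t)

namespace ImpulsiveSystem

variable {n m : ℕ}

/-- `x : [t₀, T) → ℝⁿ` (with `t₀ < T ≤ ∞`) is a solution of `Σ` for the initial time `t₀`, the
initial state `x₀` and the input `u`. Values of `x` outside `[t₀, T)` are irrelevant. -/
structure IsSolution (S : ImpulsiveSystem n m) (t₀ : ℝ) (x₀ : EuclideanSpace ℝ (Fin n))
    (u : ℝ → EuclideanSpace ℝ (Fin m)) (T : EReal) (x : ℝ → EuclideanSpace ℝ (Fin n)) :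
    Prop where
  lt : (t₀ : EReal) < T
  init : x t₀ = x₀
  flow : ∀ t₁ t₂ : ℝ, t₀ ≤ t₁ → t₁ < t₂ → (t₂ : EReal) ≤ T →
    (∀ s ∈ Ioo t₁ t₂, s ∉ S.γ.times) →
      (∀ s ∈ Ioo t₁ t₂, AbsolutelyContinuousOnInterval x t₁ s) ∧
      ∀ᵐ t ∂(volume.restrict (Ico t₁ t₂)), HasDerivAt x (S.f t (x t) (u t)) t
  jump : ∀ t ∈ S.γ.times, t₀ < t → (t : EReal) < T →
    ∃ xl : EuclideanSpace ℝ (Fin n), Tendsto x (𝓝[<] t) (𝓝 xl) ∧ x t = xl + S.g t xl (u t)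

/-- The solution `x : [t₀, T) → ℝⁿ` is maximally defined. -/
def IsMaximalSolution (S : ImpulsiveSystem n m) (t₀ : ℝ) (x₀ : EuclideanSpace ℝ (Fin n))
    (u : ℝ → EuclideanSpace ℝ (Fin m)) (T : EReal) (x : ℝ → EuclideanSpace ℝ (Fin n)) : Prop :=
  S.IsSolution t₀ x₀ u T x ∧
  ¬ ∃ (T' : EReal) (y : ℝ → EuclideanSpace ℝ (Fin n)), S.IsSolution t₀ x₀ u T' y ∧ T < T' ∧
    ∀ t : ℝ, t₀ ≤ t → (t : EReal) < T → y t = x t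

end ImpulsiveSystem

/-- `‖u_I‖_γ = max {ess sup_{t ∈ I} |u(t)|, sup_{t ∈ γ ∩ I} |u(t)|}`, as an extended nonnegative
real. -/
def inputNorm {m : ℕ} (γ : ImpulseSeq) (u : ℝ → EuclideanSpace ℝ (Fin m)) (I : Set ℝ) : ℝ≥0∞ :=
  max (essSup (fun t => ‖u t‖ₑ) (volume.restrict I)) (⨆ t ∈ γ.times ∩ I, ‖u t‖ₑ)

/-! ### Stability -/

/-- The class `ℋ` of functions `h : [0,∞) × ℝⁿ → [0,∞)`. -/
def IsMeasuringFun {n : ℕ} (h : ℝ → EuclideanSpace ℝ (Fin n) → ℝ) : Prop :=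
  ∀ t, 0 ≤ t → ∀ ξ, 0 ≤ h t ξ

/-- Strong `(hᵒ, h)`-input-to-state stability of a family of impulsive systems. For an input `u`
the quantity `inputNorm γ u (Ioc t₀ t)` is finite, so that `toReal` does not truncate. -/
def StronglyISS {n m : ℕ} {Λ : Type*} (Sys : Λ → ImpulsiveSystem n m)
    (ho h : ℝ → EuclideanSpace ℝ (Fin n) → ℝ) : Prop :=
  ∃ (β : ℝ → ℝ → ℝ) (ρ : ℝ → ℝ), IsKL β ∧ IsKInf ρ ∧
    ∀ (l : Λ) (t₀ : ℝ), 0 ≤ t₀ → ∀ (x₀ : EuclideanSpace ℝ (Fin n))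
      (u : ℝ → EuclideanSpace ℝ (Fin m)), IsInput u →
      ∀ (T : EReal) (x : ℝ → EuclideanSpace ℝ (Fin n)),
        (Sys l).IsMaximalSolution t₀ x₀ u T x →
        ∀ t : ℝ, t₀ ≤ t → (t : EReal) < T →
          h t (x t) ≤ β (ho t₀ x₀) (t - t₀ + ((Sys l).γ.count t₀ t : ℝ)) +
            ρ (inputNorm (Sys l).γ u (Ioc t₀ t)).toReal

/-! ### Lyapunov-like functions -/

/-- `V(t⁻, ξ)`. -/
def leftVal {n : ℕ} (V : ℝ → EuclideanSpace ℝ (Fin n) → ℝ) (t : ℝ)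
    (ξ : EuclideanSpace ℝ (Fin n)) : ℝ :=
  Function.leftLim (fun s => V s ξ) t

/-- The class `𝒱(γ)`: locally Lipschitz on each `[τ_k, τ_{k+1}) × ℝⁿ`, and, for `τ ∈ γ`,
`V(t, ζ)` has the finite limit `V(τ⁻, ξ)` as `(t, ζ) → (τ⁻, ξ)`. -/
def IsClassV {n : ℕ} (γ : ImpulseSeq) (V : ℝ → EuclideanSpace ℝ (Fin n) → ℝ) : Prop :=
  (∀ k : ℕ, (k : ℕ∞) ≤ γ.N →
    LocallyLipschitzOn {p : ℝ × EuclideanSpace ℝ (Fin n) | γ.τ k ≤ p.1 ∧ (p.1 : EReal) < γ.next k}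
      (fun p => V p.1 p.2)) ∧
  ∀ τ ∈ γ.times, ∀ ξ : EuclideanSpace ℝ (Fin n),
    Tendsto (fun p : ℝ × EuclideanSpace ℝ (Fin n) => V p.1 p.2) (𝓝[<] τ ×ˢ 𝓝 ξ)
      (𝓝 (leftVal V τ ξ))

/-- The upper-right Dini derivative of `V` along the flow map `f` at `(t, ξ, μ)`. -/
def upperDini {n m : ℕ}
    (f : ℝ → EuclideanSpace ℝ (Fin n) → EuclideanSpace ℝ (Fin m) → EuclideanSpace ℝ (Fin n))
    (V : ℝ → EuclideanSpace ℝ (Fin n) → ℝ) (t : ℝ) (ξ : EuclideanSpace ℝ (Fin n))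
    (μ : EuclideanSpace ℝ (Fin m)) : EReal :=
  limsup (fun s : ℝ => (((V (t + s) (ξ + s • f t ξ μ) - V t ξ) / s : ℝ) : EReal)) (𝓝[>] 0)

/-- The Lyapunov-type assumption on the family `{Σ_λ}` and the functions `hᵒ, h`, with flow bounds
`φ_λ(t, r)` (here `ph l t r`) and jump bounds `α_λ(t, r)` (here `al l t r`). -/
def LyapunovAssumption {n m : ℕ} {Λ : Type*} (Sys : Λ → ImpulsiveSystem n m)
    (ho h : ℝ → EuclideanSpace ℝ (Fin n) → ℝ) (ph al : Λ → ℝ → ℝ → ℝ) : Prop :=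
  (∀ l, IsCaratheodoryFun (Ici (0 : ℝ)) (ph l)) ∧
  (∀ l t r, 0 ≤ t → 0 ≤ r → 0 ≤ al l t r) ∧
  ∃ V : Λ → ℝ → EuclideanSpace ℝ (Fin n) → ℝ, (∀ l, IsClassV (Sys l).γ (V l)) ∧
    (∃ φ₁ φ₂ : ℝ → ℝ, IsKInf φ₁ ∧ IsKInf φ₂ ∧ ∀ l t, 0 ≤ t → ∀ ξ,
      φ₁ (h t ξ) ≤ V l t ξ ∧ V l t ξ ≤ φ₂ (ho t ξ)) ∧
    ∃ χ π : ℝ → ℝ, IsKInf χ ∧ IsKInf π ∧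
      ∀ l t, 0 ≤ t → ∀ (ξ : EuclideanSpace ℝ (Fin n)) (μ : EuclideanSpace ℝ (Fin m)),
        (t ∉ (Sys l).γ.times → χ ‖μ‖ ≤ V l t ξ →
          upperDini (Sys l).f (V l) t ξ μ ≤ ((-ph l t (V l t ξ) : ℝ) : EReal)) ∧
        (t ∈ (Sys l).γ.times → χ ‖μ‖ ≤ leftVal (V l) t ξ →
          V l t (ξ + (Sys l).g t ξ μ) ≤ al l t (leftVal (V l) t ξ)) ∧
        (t ∈ (Sys l).γ.times → leftVal (V l) t ξ ≤ χ ‖μ‖ →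
          V l t (ξ + (Sys l).g t ξ μ) ≤ π ‖μ‖)

end

/-! Let g be `φbar` in case (a) and `-φbar` in case (b), and let G(v) = ∫₁ᵛ ds/g(s), which is
strictly increasing on (0,∞). While V exceeds the input level c = χ(‖u‖), the Dini bound becomes (G
∘ V)' ≤ -φ in case (a) and (G ∘ V)' ≤ φ in case (b), so flow and jumps both act additively on G. In
(a) the flow between consecutive impulses removes at least M and a jump adds at most S < M; in (b) a
jump removes at least I and the flow between impulses adds at most P < I. Adding up, either G(V(t))
≤ G(V(t₀)) - κ(t - t₀ + n) + C with n the number of impulses in (t₀, t], or V(t) vanishes, or V(t)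
is bounded by a gain of the input alone.

The additive estimate is not enough by itself: because of C and of a possibly bounded G it need not
force V(t) to be small when V(t₀) is. It is paired with V(t) ≤ A(V(t₀)), where A vanishes
continuously at zero. In (a) at most the last jump is not yet compensated by flow, so A is the
larger of v and the running maximum of `αbar`. In (b) A is `growthBound`: it is finite because the
integral of 1/g diverges at infinity, and it vanishes at zero because the jump condition itself
forces G → -∞ there.

The flow estimate is `flowBound_of_tendsto`, brought to solutions by
`ImpulsiveSystem.IsSolution.flowBound`; `HybridBound.le_of_minDwell` and
`HybridBound.le_of_maxDwell` do the bookkeeping over impulses, and `stronglyISS_of_decaysBy` turns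
the pair of bounds into comparison functions. -/

/-! ### Domination by comparison functions -/

/-- The average `∫₁² b (r σ) dσ` of `b` over `[r, 2r]`. -/
noncomputable def dyadicAverage (b : ℝ → ℝ) (r : ℝ) : ℝ := ∫ σ in (1 : ℝ)..2, b (r * σ)

section DyadicAverage

variable {b b' : ℝ → ℝ}

lemma Monotone.intervalIntegrable_mul_left (hb : Monotone b) {r : ℝ} (hr : 0 ≤ r) (p q : ℝ) :
    IntervalIntegrable (fun σ => b (r * σ)) volume p q :=
  (hb.comp (monotone_mul_left_of_nonneg hr)).intervalIntegrable

lemma le_dyadicAverage (hb : Monotone b) {r : ℝ} (hr : 0 ≤ r) : b r ≤ dyadicAverage b r := by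
  have h := intervalIntegral.integral_mono_on (a := (1 : ℝ)) (b := 2) (by norm_num)
    (f := fun _ => b r) (by simp) (hb.intervalIntegrable_mul_left hr 1 2)
    (fun σ hσ => hb (by nlinarith [hσ.1]))
  simpa [dyadicAverage, show (2 : ℝ) - 1 = 1 by norm_num] using h

lemma dyadicAverage_le (hb : Monotone b) {r : ℝ} (hr : 0 ≤ r) :
    dyadicAverage b r ≤ b (2 * r) := by
  have h := intervalIntegral.integral_mono_on (a := (1 : ℝ)) (b := 2) (by norm_num)
    (g := fun _ => b (2 * r)) (hb.intervalIntegrable_mul_left hr 1 2) (by simp)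
    (fun σ hσ => hb (by nlinarith [hσ.2]))
  simpa [dyadicAverage, show (2 : ℝ) - 1 = 1 by norm_num] using h

lemma dyadicAverage_mono (hb : Monotone b) (hb' : Monotone b') (h : ∀ r, 0 ≤ r → b r ≤ b' r)
    {r r' : ℝ} (hr : 0 ≤ r) (hrr : r ≤ r') : dyadicAverage b r ≤ dyadicAverage b' r' := by
  refine intervalIntegral.integral_mono_on (by norm_num) (hb.intervalIntegrable_mul_left hr 1 2)
    (hb'.intervalIntegrable_mul_left (hr.trans hrr) 1 2) fun σ hσ => ?_
  have : 0 ≤ σ := by linarith [hσ.1]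
  exact (h _ (by positivity)).trans (hb' (by gcongr))

/-- For r > 0 the average is r⁻¹ ∫ᵣ²ʳ b, continuous even if b has jumps; at zero it is squeezed
between 0 and b(2r). -/
lemma continuousOn_dyadicAverage (hb : Monotone b) (h0 : b 0 = 0)
    (hlim : Tendsto b (𝓝[>] 0) (𝓝 0)) : ContinuousOn (dyadicAverage b) (Ici 0) := by
  intro r hr
  rcases eq_or_lt_of_le (show (0 : ℝ) ≤ r from hr) with rfl | hr
  · have hz : dyadicAverage b 0 = 0 := by simp [dyadicAverage, h0]
    rw [← Ioi_insert, continuousWithinAt_insert_self, ContinuousWithinAt, hz]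
    have h2 : Tendsto (fun r : ℝ => b (2 * r)) (𝓝[>] 0) (𝓝 0) := by
      refine hlim.comp (tendsto_nhdsWithin_iff.2 ⟨?_, ?_⟩)
      · have : ContinuousAt (fun r : ℝ => 2 * r) 0 := by fun_prop
        simpa [ContinuousAt] using this.tendsto.mono_left (nhdsWithin_le_nhds (s := Ioi 0))
      · filter_upwards [self_mem_nhdsWithin] with r hr
        simpa using hr
    refine tendsto_of_tendsto_of_tendsto_of_le_of_le' tendsto_const_nhds h2 ?_ ?_
    · filter_upwards [self_mem_nhdsWithin] with r hr
      have hr : (0 : ℝ) < r := hr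
      exact (h0 ▸ hb hr.le).trans (le_dyadicAverage hb hr.le)
    · filter_upwards [self_mem_nhdsWithin] with r hr
      exact dyadicAverage_le hb (le_of_lt hr)
  · have hint : ∀ p q, IntervalIntegrable b volume p q := fun p q => hb.intervalIntegrable
    have hc : Continuous fun r => ∫ σ in (0 : ℝ)..r, b σ :=
      intervalIntegral.continuous_primitive hint 0
    have : ContinuousAt (fun r => r⁻¹ * ((∫ σ in (0 : ℝ)..2 * r, b σ) - ∫ σ in (0 : ℝ)..r, b σ)) r :=
      (continuousAt_inv₀ hr.ne').mul
        ((hc.comp (continuous_const.mul continuous_id)).sub hc).continuousAt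
    refine (this.congr ?_).continuousWithinAt
    filter_upwards [lt_mem_nhds hr] with x hx
    rw [dyadicAverage, intervalIntegral.integral_comp_mul_left _ hx.ne',
      intervalIntegral.integral_interval_sub_left (hint _ _) (hint _ _), mul_one, mul_comm x 2,
      smul_eq_mul]

/-- The averaged function may be constant on intervals or bounded; the linear term repairs both. -/
lemma isKInf_dyadicAverage_add (hb : Monotone b) (h0 : b 0 = 0)
    (hlim : Tendsto b (𝓝[>] 0) (𝓝 0)) {c : ℝ} (hc : 0 < c) :
    IsKInf fun r => dyadicAverage b r + r * c := by
  refine ⟨(continuousOn_dyadicAverage hb h0 hlim).add (by fun_prop), fun r hr r' _ hrr => ?_,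
    by simp [dyadicAverage, h0], ?_⟩
  · have h1 := dyadicAverage_mono hb hb (fun _ _ => le_rfl) hr hrr.le
    have h2 : r * c < r' * c := by gcongr
    show _ + _ < _ + _
    linarith
  · rintro ⟨C, hC⟩
    have h1 := hC ⟨(|C| + 1) / c, show (0 : ℝ) ≤ _ by positivity, rfl⟩
    have h2 : (0 : ℝ) ≤ (|C| + 1) / c := by positivity
    have h3 := (h0 ▸ hb h2).trans (le_dyadicAverage hb h2)
    have h4 : (|C| + 1) / c * c = |C| + 1 := by field_simp
    simp only [h4] at h1
    linarith [le_abs_self C]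

end DyadicAverage

lemma tendsto_comp_max_zero {f : ℝ → ℝ} (hf : Tendsto f (𝓝[>] 0) (𝓝 0)) :
    Tendsto (fun r => f (max r 0)) (𝓝[>] 0) (𝓝 0) := by
  refine hf.congr' ?_
  filter_upwards [self_mem_nhdsWithin] with r hr
  rw [max_eq_left (le_of_lt hr)]

/-- A function that is nondecreasing, vanishes at zero and is continuous there is dominated by a
function of class `𝒦∞`. -/
theorem exists_isKInf_ge {R : ℝ → ℝ} (hmono : MonotoneOn R (Ici 0)) (h0 : R 0 = 0)
    (hlim : Tendsto R (𝓝[>] 0) (𝓝 0)) : ∃ ρ, IsKInf ρ ∧ ∀ r, 0 ≤ r → R r ≤ ρ r := by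
  have hb : Monotone fun r => R (max r 0) := fun r r' h =>
    hmono (mem_Ici.2 (le_max_right _ _)) (mem_Ici.2 (le_max_right _ _)) (max_le_max_right 0 h)
  refine ⟨_, isKInf_dyadicAverage_add hb (by simpa using h0) (tendsto_comp_max_zero hlim) one_pos,
    fun r hr => ?_⟩
  have := le_dyadicAverage hb hr
  simp only [max_eq_left hr] at this
  linarith

/-- A function of two variables that is nondecreasing in the first and nonincreasing in the second
one, tends to zero in the second variable, and is continuous with value zero at `(0, 0)`, is
dominated by a function of class `𝒦ℒ`. -/
theorem exists_isKL_ge {B : ℝ → ℝ → ℝ} (hmono : ∀ s, 0 ≤ s → MonotoneOn (fun r => B r s) (Ici 0))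
    (hanti : ∀ r, 0 ≤ r → AntitoneOn (B r) (Ici 0)) (hnonneg : ∀ r s, 0 ≤ r → 0 ≤ s → 0 ≤ B r s)
    (h0 : B 0 0 = 0) (hlim : Tendsto (fun r => B r 0) (𝓝[>] 0) (𝓝 0))
    (hdecay : ∀ r, 0 ≤ r → Tendsto (B r) atTop (𝓝 0)) :
    ∃ β, IsKL β ∧ ∀ r s, 0 ≤ r → 0 ≤ s → B r s ≤ β r s := by
  have hb : ∀ s, 0 ≤ s → Monotone fun r => B (max r 0) s := fun s hs r r' h =>
    hmono s hs (mem_Ici.2 (le_max_right _ _)) (mem_Ici.2 (le_max_right _ _)) (max_le_max_right 0 h)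
  have hle0 : ∀ r s, 0 ≤ r → 0 ≤ s → B r s ≤ B r 0 := fun r s hr hs =>
    hanti r hr (le_refl (0 : ℝ)) hs hs
  have hz : ∀ s, 0 ≤ s → B 0 s = 0 := fun s hs =>
    le_antisymm ((hle0 0 s le_rfl hs).trans_eq h0) (hnonneg 0 s le_rfl hs)
  -- The slope (1 + s)⁻¹ gives strict growth in r for each s and still decays to zero in s.
  refine ⟨fun r s => dyadicAverage (fun r => B (max r 0) s) r + r * (1 + s)⁻¹,
    ⟨fun s hs => isKInf_dyadicAverage_add (hb s hs) (by simpa using hz s hs)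
      (tendsto_comp_max_zero (f := fun r => B r s) ?_) (by positivity), fun r hr => ⟨?_, ?_⟩⟩, ?_⟩
  · refine tendsto_of_tendsto_of_tendsto_of_le_of_le' tendsto_const_nhds hlim ?_ ?_
    · filter_upwards [self_mem_nhdsWithin] with r hr using hnonneg r s (le_of_lt hr) hs
    · filter_upwards [self_mem_nhdsWithin] with r hr using hle0 r s (le_of_lt hr) hs
  · intro s hs s' hs' hss
    have h1 := dyadicAverage_mono (hb s' hs') (hb s hs)
      (fun r _ => hanti _ (le_max_right r 0) hs hs' hss) hr le_rfl
    have hs : (0 : ℝ) ≤ s := hs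
    have h2 : (1 + s')⁻¹ ≤ (1 + s)⁻¹ := by gcongr
    have h3 := mul_le_mul_of_nonneg_left h2 hr
    show _ + _ ≤ _ + _
    linarith
  · have h1 : Tendsto (fun s : ℝ => r * (1 + s)⁻¹) atTop (𝓝 0) := by
      simpa using (tendsto_inv_atTop_zero.comp (tendsto_atTop_add_const_left atTop (1 : ℝ)
        tendsto_id)).const_mul r
    have h2 : Tendsto (fun s => dyadicAverage (fun r => B (max r 0) s) r) atTop (𝓝 0) := by
      refine tendsto_of_tendsto_of_tendsto_of_le_of_le' tendsto_const_nhds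
        (hdecay (2 * r) (by positivity)) ?_ ?_
      · filter_upwards [eventually_ge_atTop 0] with s hs
        exact (hnonneg _ s (le_max_right r 0) hs).trans (le_dyadicAverage (hb s hs) hr)
      · filter_upwards [eventually_ge_atTop 0] with s hs
        have := dyadicAverage_le (hb s hs) hr
        rwa [max_eq_left (by positivity)] at this
    simpa using h2.add h1
  · intro r s hr hs
    have h1 := le_dyadicAverage (hb s hs) hr
    have h2 : 0 ≤ r * (1 + s)⁻¹ := by positivity
    simp only [max_eq_left hr] at h1
    simp only
    linarith

/-! ### The primitive of `1 / g` -/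

section Primitive

variable {g : ℝ → ℝ}

lemma intervalIntegrable_one_div (hg : ContinuousOn g (Ici 0)) (hpos : ∀ r, 0 < r → 0 < g r)
    {a b : ℝ} (ha : 0 < a) (hb : 0 < b) : IntervalIntegrable (fun s => 1 / g s) volume a b := by
  refine ContinuousOn.intervalIntegrable (continuousOn_const.div (hg.mono ?_) ?_) <;>
  · intro x hx
    have : 0 < x := (lt_min ha hb).trans_le hx.1
    first | exact this.le | exact (hpos x this).ne'

/-- The primitive `v ↦ ∫₁ᵛ ds / g(s)`. -/
noncomputable def recipPrimitive (g : ℝ → ℝ) (v : ℝ) : ℝ := ∫ s in (1 : ℝ)..v, 1 / g s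

lemma integral_one_div_eq_sub (hg : ContinuousOn g (Ici 0)) (hpos : ∀ r, 0 < r → 0 < g r)
    {a b : ℝ} (ha : 0 < a) (hb : 0 < b) :
    ∫ s in a..b, 1 / g s = recipPrimitive g b - recipPrimitive g a :=
  (intervalIntegral.integral_interval_sub_left (intervalIntegrable_one_div hg hpos one_pos hb)
    (intervalIntegrable_one_div hg hpos one_pos ha)).symm

lemma strictMonoOn_recipPrimitive (hg : ContinuousOn g (Ici 0)) (hpos : ∀ r, 0 < r → 0 < g r) :
    StrictMonoOn (recipPrimitive g) (Ioi 0) := by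
  intro a ha b hb hab
  have ha : 0 < a := ha
  rw [← sub_pos, ← integral_one_div_eq_sub hg hpos ha hb]
  exact intervalIntegral.intervalIntegral_pos_of_pos_on
    (intervalIntegrable_one_div hg hpos ha hb)
    (fun x hx => one_div_pos.2 (hpos x (ha.trans hx.1))) hab

lemma hasDerivAt_recipPrimitive (hg : ContinuousOn g (Ici 0)) (hpos : ∀ r, 0 < r → 0 < g r)
    {v : ℝ} (hv : 0 < v) : HasDerivAt (recipPrimitive g) (1 / g v) v := by
  have hc : ContinuousOn (fun s => 1 / g s) (Ioi 0) :=
    continuousOn_const.div (hg.mono Ioi_subset_Ici_self) fun x hx => (hpos x hx).ne'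
  exact intervalIntegral.integral_hasDerivAt_right (intervalIntegrable_one_div hg hpos one_pos hv)
    (hc.stronglyMeasurableAtFilter isOpen_Ioi v hv) (hc.continuousAt (Ioi_mem_nhds hv))

lemma continuousOn_recipPrimitive (hg : ContinuousOn g (Ici 0)) (hpos : ∀ r, 0 < r → 0 < g r) :
    ContinuousOn (recipPrimitive g) (Ioi 0) := fun _ hv =>
  (hasDerivAt_recipPrimitive hg hpos hv).continuousAt.continuousWithinAt

/-- A bounded primitive of a positive function would make it integrable on (1,∞). -/
lemma exists_lt_recipPrimitive (hg : ContinuousOn g (Ici 0)) (hpos : ∀ r, 0 < r → 0 < g r)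
    (hdiv : ∫⁻ s in Ioi (1 : ℝ), ENNReal.ofReal (1 / g s) = ⊤) (C : ℝ) :
    ∃ w, 0 < w ∧ C < recipPrimitive g w := by
  by_contra! hC
  have hint : IntegrableOn (fun s => 1 / g s) (Ioi 1) := by
    refine integrableOn_Ioi_of_intervalIntegral_norm_bounded (l := atTop) (b := fun x : ℝ => x)
      C 1 (fun i => ?_) tendsto_id ?_
    · rcases le_or_gt i 1 with h | h
      · simp [Ioc_eq_empty_of_le h]
      · exact (intervalIntegrable_one_div hg hpos one_pos (one_pos.trans h)).1
    · filter_upwards [eventually_ge_atTop 1] with i hi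
      refine le_of_eq_of_le (intervalIntegral.integral_congr fun x hx => ?_)
        (hC i (one_pos.trans_le hi))
      rw [uIcc_of_le hi] at hx
      exact Real.norm_of_nonneg (one_div_pos.2 (hpos x (one_pos.trans_le hx.1))).le
  exact hint.lintegral_lt_top.ne hdiv

/-- If each `a > 0` can be moved down by an amount that lowers `G` by at least `I > 0`, then `G`
tends to `-∞` at zero. -/
lemma exists_forall_lt_of_strictMonoOn {G α : ℝ → ℝ} (hG : StrictMonoOn G (Ioi 0))
    (hα : ∀ a, 0 < a → 0 < α a) {I : ℝ} (hI : 0 < I) (hdrop : ∀ a, 0 < a → G (α a) + I ≤ G a)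
    (C : ℝ) : ∃ ε, 0 < ε ∧ ∀ w, 0 < w → w ≤ ε → G w < C := by
  -- The point is the k-th iterate of `α` at 1; each application lowers G by at least I.
  suffices h : ∀ k : ℕ, ∃ a, 0 < a ∧ G a ≤ G 1 - k * I by
    obtain ⟨k, hk⟩ := exists_nat_gt ((G 1 - C) / I)
    obtain ⟨a, ha, hGa⟩ := h k
    rw [div_lt_iff₀ hI] at hk
    exact ⟨a, ha, fun w hw hwa => (hG.monotoneOn hw ha hwa).trans_lt (by linarith)⟩
  intro k
  induction k with
  | zero => exact ⟨1, one_pos, by simp⟩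
  | succ k ih =>
    obtain ⟨a, ha, hGa⟩ := ih
    refine ⟨α a, hα a ha, ?_⟩
    push_cast
    linarith [hdrop a ha]

end Primitive

/-! ### Comparison along a flow -/

/-- The value `w` reached at time `b` by a function `W` started at time `a` is either at most `c`,
or it obeys `G w + ∫ₛᵇ ψ ≤ G (W s)` for some `s` that is the initial time or has `W s ≤ c`. -/
def FlowBound (G ψ W : ℝ → ℝ) (c a b w : ℝ) : Prop :=
  w ≤ c ∨ ∃ s ∈ Icc a b, (s = a ∨ W s ≤ c) ∧ 0 < W s ∧ G w + ∫ r in s..b, ψ r ≤ G (W s)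

/-- After the last time s₀ at which W ≤ c (or after `a` if there is none) the decrease hypothesis
applies throughout, and passing to the limit at both ends gives the estimate from s₀ to b. The
alternative `hzero` excludes W(s₀) = 0: either W cannot increase above c, or leaving zero would
require climbing from G = -∞. -/
theorem flowBound_of_tendsto {G ψ W : ℝ → ℝ} {a b c w : ℝ} (hab : a < b) (hc : 0 ≤ c)
    (hGmono : StrictMonoOn G (Ioi 0)) (hGcont : ContinuousOn G (Ioi 0))
    (hψ : IntervalIntegrable ψ volume a b)
    (hzero : (∀ r ∈ Icc a b, 0 ≤ ψ r) ∨ ∀ C, ∃ ε, 0 < ε ∧ ∀ w, 0 < w → w ≤ ε → G w < C)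
    (hW : ContinuousOn W (Ico a b)) (hw : Tendsto W (𝓝[<] b) (𝓝 w))
    (hdec : ∀ s t, a < s → s ≤ t → t < b → (∀ r ∈ Icc s t, c < W r) →
      G (W t) + ∫ r in s..t, ψ r ≤ G (W s)) : FlowBound G ψ W c a b w := by
  rcases le_or_gt w c with hwc | hwc
  · exact Or.inl hwc
  refine Or.inr ?_
  have hw0 : 0 < w := hc.trans_lt hwc
  have hGw : ContinuousAt G w := hGcont.continuousAt (Ioi_mem_nhds hw0)
  have hψ' : ∀ {p q}, p ∈ Icc a b → q ∈ Icc a b → IntervalIntegrable ψ volume p q := by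
    intro p q hp hq
    exact hψ.mono_set (by rw [uIcc_of_le hab.le]; exact uIcc_subset_Icc hp hq)
  have hΨ : ContinuousOn (fun t => ∫ r in a..t, ψ r) (Icc a b) := by
    have := intervalIntegral.continuousOn_primitive_interval' hψ (a := a) left_mem_uIcc
    rwa [uIcc_of_le hab.le] at this
  have hsub : ∀ {p q}, p ∈ Icc a b → q ∈ Icc a b →
      ∫ r in p..q, ψ r = (∫ r in a..q, ψ r) - ∫ r in a..p, ψ r := fun hp hq =>
    (intervalIntegral.integral_interval_sub_left (hψ' (left_mem_Icc.2 hab.le) hq)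
      (hψ' (left_mem_Icc.2 hab.le) hp)).symm
  -- the last time before `b` at which `W ≤ c`
  obtain ⟨d, hdb, hd⟩ : ∃ d, d < b ∧ ∀ s ∈ Ioo d b, c < W s := by
    have := hw.eventually (lt_mem_nhds hwc)
    rw [eventually_nhdsWithin_iff] at this
    obtain ⟨d, hdb, hd⟩ := (exists_Ioc_subset_of_mem_nhds this ⟨a, hab⟩)
    exact ⟨d, hdb, fun s hs => hd ⟨hs.1, hs.2.le⟩ hs.2⟩
  obtain ⟨s₀, hs₀, hstart, habove⟩ : ∃ s₀ ∈ Ico a b, (s₀ = a ∨ W s₀ ≤ c) ∧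
      ∀ s ∈ Ioo s₀ b, c < W s := by
    have hmb : max a d < b := max_lt hab hdb
    -- W > c on (d, b), so cutting at max(a, d) loses nothing and makes the set compact, although W
    -- is controlled only on [a, b).
    set S : Set ℝ := Icc a (max a d) ∩ W ⁻¹' Iic c
    have hS : IsCompact S := by
      refine isCompact_Icc.of_isClosed_subset ?_ inter_subset_left
      exact (hW.mono fun s hs => ⟨hs.1, hs.2.trans_lt hmb⟩).preimage_isClosed_of_isClosed
        isClosed_Icc isClosed_Iic
    rcases S.eq_empty_or_nonempty with hSe | hSne
    · refine ⟨a, ⟨le_rfl, hab⟩, Or.inl rfl, fun s hs => ?_⟩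
      by_contra! hle
      rcases le_or_gt s (max a d) with h | h
      · exact (hSe ▸ (⟨⟨hs.1.le, h⟩, hle⟩ : s ∈ S) : s ∈ (∅ : Set ℝ))
      · exact absurd (hd s ⟨(le_max_right _ _).trans_lt h, hs.2⟩) hle.not_gt
    · have hmem := hS.sSup_mem hSne
      refine ⟨sSup S, ⟨hmem.1.1, hmem.1.2.trans_lt hmb⟩, Or.inr hmem.2, fun s hs => ?_⟩
      by_contra! hle
      rcases le_or_gt s (max a d) with h | h
      · exact absurd (le_csSup hS.bddAbove
          (⟨⟨hmem.1.1.trans hs.1.le, h⟩, hle⟩ : s ∈ S)) hs.1.not_ge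
      · exact absurd (hd s ⟨(le_max_right _ _).trans_lt h, hs.2⟩) hle.not_gt
  have hs₀' : s₀ ∈ Icc a b := ⟨hs₀.1, hs₀.2.le⟩
  have hb' : b ∈ Icc a b := right_mem_Icc.2 hab.le
  have hkey : ∀ s ∈ Ioo s₀ b, G w + ((∫ r in a..b, ψ r) - ∫ r in a..s, ψ r) ≤ G (W s) := by
    intro s hs
    have hsI : s ∈ Icc a b := ⟨hs₀.1.trans hs.1.le, hs.2.le⟩
    have h1 : Tendsto (fun t => G (W t) + ((∫ r in a..t, ψ r) - ∫ r in a..s, ψ r)) (𝓝[<] b)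
        (𝓝 (G w + ((∫ r in a..b, ψ r) - ∫ r in a..s, ψ r))) := by
      refine (hGw.tendsto.comp hw).add (Tendsto.sub ?_ tendsto_const_nhds)
      refine (hΨ b hb').mono_left ?_
      rw [← nhdsWithin_Ioo_eq_nhdsLT hab]
      exact nhdsWithin_mono _ Ioo_subset_Icc_self
    refine le_of_tendsto h1 ?_
    filter_upwards [Ioo_mem_nhdsLT hs.2] with t ht
    rw [← hsub hsI ⟨hsI.1.trans ht.1.le, ht.2.le⟩]
    exact hdec s t (hs₀.1.trans_lt hs.1) ht.1.le ht.2
      fun r hr => habove r ⟨hs.1.trans_le hr.1, hr.2.trans_lt ht.2⟩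
  have hIoo : Ioo s₀ b ∈ 𝓝[>] s₀ := Ioo_mem_nhdsGT hs₀.2
  have hWs : Tendsto W (𝓝[>] s₀) (𝓝 (W s₀)) := by
    rw [← nhdsWithin_Ioo_eq_nhdsGT hs₀.2]
    exact (hW s₀ hs₀).mono fun s hs => ⟨hs₀.1.trans hs.1.le, hs.2⟩
  have hWpos : 0 < W s₀ := by
    by_contra! hle
    -- `hkey` keeps W away from zero to the right of s₀, against right continuity at s₀. For ψ ≥ 0
    -- take ε = w; otherwise G(W s) is bounded below, because the primitive of ψ is bounded above on
    -- [a, b].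
    obtain ⟨ε, hε, hbad⟩ : ∃ ε, 0 < ε ∧ ∀ s ∈ Ioo s₀ b, ¬ W s < ε := by
      rcases hzero with hz | hz
      · refine ⟨w, hw0, fun s hs hlt => ?_⟩
        have hsI : s ∈ Icc a b := ⟨hs₀.1.trans hs.1.le, hs.2.le⟩
        have h1 := hkey s hs
        rw [← hsub hsI hb'] at h1
        have h2 : 0 ≤ ∫ r in s..b, ψ r :=
          intervalIntegral.integral_nonneg hs.2.le fun r hr => hz r ⟨hsI.1.trans hr.1, hr.2⟩
        have h3 := hGmono (hc.trans_lt (habove s hs)) hw0 hlt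
        linarith
      · obtain ⟨t, -, ht⟩ := isCompact_Icc.exists_isMaxOn (nonempty_Icc.2 hab.le) hΨ
        obtain ⟨ε, hε, hlt⟩ := hz (G w + ((∫ r in a..b, ψ r) - ∫ r in a..t, ψ r))
        refine ⟨ε, hε, fun s hs hs' => ?_⟩
        have hsI : s ∈ Icc a b := ⟨hs₀.1.trans hs.1.le, hs.2.le⟩
        have h1 := hkey s hs
        have h2 := hlt (W s) (hc.trans_lt (habove s hs)) hs'.le
        have h3 : (∫ r in a..s, ψ r) ≤ ∫ r in a..t, ψ r := ht hsI
        linarith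
    obtain ⟨s, hs, hs'⟩ := ((hWs.eventually (gt_mem_nhds (hle.trans_lt hε))).and hIoo).exists
    exact hbad s hs' hs
  refine ⟨s₀, hs₀', hstart, hWpos, ?_⟩
  rw [hsub hs₀' hb']
  refine le_of_tendsto_of_tendsto (b := 𝓝[>] s₀)
    (f := fun s => G w + ((∫ r in a..b, ψ r) - ∫ r in a..s, ψ r)) (g := fun s => G (W s)) ?_
    ((hGcont.continuousAt (Ioi_mem_nhds hWpos)).tendsto.comp hWs) ?_
  · refine tendsto_const_nhds.add (tendsto_const_nhds.sub ?_)
    rw [← nhdsWithin_Ioo_eq_nhdsGT hs₀.2]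
    exact (hΨ s₀ hs₀').mono fun s hs => ⟨hs₀.1.trans hs.1.le, hs.2.le⟩
  · filter_upwards [hIoo] with s hs using hkey s hs

/-! ### Absolute continuity of compositions -/

namespace AbsolutelyContinuousOnInterval

variable {X Y : Type*} [PseudoMetricSpace X] [PseudoMetricSpace Y] {a b : ℝ}

lemma comp_lipschitzOnWith {f : ℝ → X} {F : X → Y} {K : NNReal} {s : Set X}
    (hF : LipschitzOnWith K F s) (hf : AbsolutelyContinuousOnInterval f a b)
    (hs : ∀ t ∈ uIcc a b, f t ∈ s) : AbsolutelyContinuousOnInterval (fun t => F (f t)) a b := by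
  have hlim := Tendsto.const_mul (K : ℝ) hf
  rw [mul_zero] at hlim
  refine squeeze_zero' (Eventually.of_forall fun E => Finset.sum_nonneg fun _ _ => dist_nonneg)
    ?_ hlim
  filter_upwards [mem_inf_of_right (mem_principal_self _)] with E hE
  rw [Finset.mul_sum]
  refine Finset.sum_le_sum fun i hi => hF.dist_le_mul _ (hs _ ?_) _ (hs _ ?_)
  · exact (hE.1 i hi).1
  · exact (hE.1 i hi).2

lemma prodMk {f : ℝ → X} {g : ℝ → Y} (hf : AbsolutelyContinuousOnInterval f a b)
    (hg : AbsolutelyContinuousOnInterval g a b) :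
    AbsolutelyContinuousOnInterval (fun t => (f t, g t)) a b := by
  have hlim := Tendsto.add hf hg
  rw [add_zero] at hlim
  refine squeeze_zero (fun E => Finset.sum_nonneg fun _ _ => dist_nonneg) (fun E => ?_) hlim
  rw [← Finset.sum_add_distrib]
  exact Finset.sum_le_sum fun i _ => max_le_add_of_nonneg dist_nonneg dist_nonneg

end AbsolutelyContinuousOnInterval

/-- If `G' = 1 / g`, and `W > 0` is absolutely continuous with `W' ≤ -ψ g(W)`, then
`G ∘ W + ∫ ψ` does not increase. -/
theorem recipPrimitive_add_integral_le {g ψ W : ℝ → ℝ} {a b : ℝ} (hab : a ≤ b)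
    (hg : ContinuousOn g (Ici 0)) (hpos : ∀ r, 0 < r → 0 < g r)
    (hψ : IntervalIntegrable ψ volume a b) (hW : AbsolutelyContinuousOnInterval W a b)
    (hWpos : ∀ t ∈ Icc a b, 0 < W t)
    (hderiv : ∀ᵐ t, t ∈ Ioo a b → DifferentiableAt ℝ W t → deriv W t ≤ -(ψ t * g (W t))) :
    recipPrimitive g (W b) + ∫ t in a..b, ψ t ≤ recipPrimitive g (W a) := by
  have hWc : ContinuousOn W (Icc a b) := by simpa [uIcc_of_le hab] using hW.continuousOn
  -- The primitive is C¹ on (0,∞) and W maps [a, b] to a compact subset, so the composition stays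
  -- absolutely continuous and can be recovered from its derivative.
  obtain ⟨K, hK⟩ : ∃ K, LipschitzOnWith K (recipPrimitive g) (W '' Icc a b) := by
    refine LocallyLipschitzOn.exists_lipschitzOnWith_of_compact (isCompact_Icc.image_of_continuousOn
      hWc) ?_
    rintro _ ⟨t, ht, rfl⟩
    have hder : ∀ v ∈ Ioi (0 : ℝ), HasDerivAt (recipPrimitive g) (1 / g v) v := fun v hv =>
      hasDerivAt_recipPrimitive hg hpos hv
    have hC1 : ContDiffOn ℝ 1 (recipPrimitive g) (Ioi 0) := by
      rw [show (1 : WithTop ℕ∞) = 0 + 1 from rfl, contDiffOn_succ_iff_deriv_of_isOpen isOpen_Ioi]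
      refine ⟨fun v hv => (hder v hv).differentiableAt.differentiableWithinAt, by simp, ?_⟩
      rw [contDiffOn_zero]
      have : ContinuousOn (fun s => 1 / g s) (Ioi 0) :=
        continuousOn_const.div (hg.mono Ioi_subset_Ici_self) fun x hx => (hpos x hx).ne'
      exact this.congr fun v hv => (hder v hv).deriv
    obtain ⟨K, u, hu, hKu⟩ := (hC1.contDiffAt (Ioi_mem_nhds (hWpos t ht))).exists_lipschitzOnWith
    exact ⟨K, u, mem_nhdsWithin_of_mem_nhds hu, hKu⟩
  have hGW : AbsolutelyContinuousOnInterval (fun t => recipPrimitive g (W t)) a b :=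
    hW.comp_lipschitzOnWith hK fun t ht => ⟨t, by rwa [uIcc_of_le hab] at ht, rfl⟩
  have hle : ∫ t in a..b, deriv (fun t => recipPrimitive g (W t)) t ≤ ∫ t in a..b, -ψ t := by
    refine intervalIntegral.integral_mono_ae_restrict hab hGW.intervalIntegrable_deriv hψ.neg ?_
    rw [EventuallyLE, ae_restrict_iff' measurableSet_Icc]
    have hne : ∀ᵐ t : ℝ, t ≠ a ∧ t ≠ b :=
      (ae_iff.2 (by simp) : ∀ᵐ t : ℝ, t ≠ a).and
        (ae_iff.2 (by simp) : ∀ᵐ t : ℝ, t ≠ b)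
    filter_upwards [hderiv, hW.ae_differentiableAt, hne] with t h1 h2 h3 ht
    have hd := h2 (by rwa [uIcc_of_le hab])
    have hpt := hWpos t ht
    have h4 := h1 ⟨lt_of_le_of_ne ht.1 h3.1.symm, lt_of_le_of_ne ht.2 h3.2⟩ hd
    have h5 := (hasDerivAt_recipPrimitive hg hpos hpt).comp t hd.hasDerivAt
    have hgt := hpos _ hpt
    rw [show (fun t => recipPrimitive g (W t)) = recipPrimitive g ∘ W from rfl, h5.deriv,
      one_div, inv_mul_le_iff₀ hgt]
    linarith
  rw [hGW.integral_deriv_eq_sub, intervalIntegral.integral_neg] at hle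
  linarith

/-- An upper bound for the Dini derivative of a Lipschitz `V` in the direction of the tangent of a
curve `x` bounds the derivative of `V` along `x`. -/
theorem deriv_le_of_limsup_le {E : Type*} [NormedAddCommGroup E] [NormedSpace ℝ E]
    {V : ℝ → E → ℝ} {x : ℝ → E} {v : E} {t c : ℝ} {K : NNReal} {D : Set (ℝ × E)}
    (hV : LipschitzOnWith K (fun p => V p.1 p.2) D)
    (hD : D ∈ 𝓝[{p : ℝ × E | t ≤ p.1}] (t, x t)) (hx : HasDerivAt x v t)
    (hW : DifferentiableAt ℝ (fun s => V s (x s)) t)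
    (hc : limsup (fun s : ℝ => (((V (t + s) (x t + s • v) - V t (x t)) / s : ℝ) : EReal)) (𝓝[>] 0)
      ≤ (c : EReal)) : deriv (fun s => V s (x s)) t ≤ c := by
  have hslope : Tendsto (fun s : ℝ => s⁻¹ * (V (t + s) (x (t + s)) - V t (x t))) (𝓝[>] 0)
      (𝓝 (deriv (fun s => V s (x s)) t)) :=
    (hasDerivAt_iff_tendsto_slope_zero.1 hW.hasDerivAt).mono_left
      (nhdsWithin_mono _ fun s hs => ne_of_gt hs)
  have hxslope : Tendsto (fun s : ℝ => s⁻¹ • (x (t + s) - x t) - v) (𝓝[>] 0) (𝓝 0) := by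
    have h : Tendsto (fun s : ℝ => s⁻¹ • (x (t + s) - x t)) (𝓝[>] 0) (𝓝 v) :=
      (hasDerivAt_iff_tendsto_slope_zero.1 hx).mono_left
        (nhdsWithin_mono _ fun s hs => ne_of_gt hs)
    simpa using h.sub_const v
  have hmem : ∀ y : ℝ → E, ContinuousAt y 0 → y 0 = x t →
      ∀ᶠ s : ℝ in 𝓝[>] 0, (t + s, y s) ∈ D := by
    intro y hy hy0
    have h1 : Tendsto (fun s : ℝ => (t + s, y s)) (𝓝[>] 0)
        (𝓝[{p : ℝ × E | t ≤ p.1}] (t, x t)) := by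
      refine tendsto_nhdsWithin_iff.2 ⟨?_, ?_⟩
      · have h2 : ContinuousAt (fun s : ℝ => (t + s, y s)) 0 :=
          (continuousAt_const.add continuousAt_id).prodMk hy
        have h3 := h2.tendsto.mono_left (nhdsWithin_le_nhds (s := Ioi (0 : ℝ)))
        simpa [hy0] using h3
      · filter_upwards [self_mem_nhdsWithin] with s hs
        have : (0 : ℝ) < s := hs
        simpa using this.le
    exact h1 hD
  have hm1 := hmem (fun s => x (t + s))
    (ContinuousAt.comp (by simpa using hx.continuousAt) (by fun_prop)) (by simp)
  have hm2 := hmem (fun s => x t + s • v) (by fun_prop) (by simp)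
  -- The tangent line and the curve differ by o(s), and V is Lipschitz on `D`, so the two difference
  -- quotients have the same limit. Only times to the right of t matter, so a one-sided
  -- neighbourhood suffices.
  have hdiff : Tendsto (fun s : ℝ => s⁻¹ * (V (t + s) (x t + s • v) - V (t + s) (x (t + s))))
      (𝓝[>] 0) (𝓝 0) := by
    have hlim := hxslope.norm.const_mul (K : ℝ)
    rw [norm_zero, mul_zero] at hlim
    refine squeeze_zero_norm' ?_ hlim
    filter_upwards [hm1, hm2, self_mem_nhdsWithin] with s h1 h2 hs
    have hs : (0 : ℝ) < s := hs
    have h3 := hV.dist_le_mul _ h2 _ h1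
    rw [Real.dist_eq, dist_eq_norm, Prod.norm_def] at h3
    simp only [Prod.fst_sub, Prod.snd_sub, sub_self, norm_zero, norm_nonneg, sup_of_le_right] at h3
    have h4 : s⁻¹ • (x (t + s) - x t) - v = -(s⁻¹ • (x t + s • v - x (t + s))) := by
      rw [smul_sub, smul_sub, smul_add, inv_smul_smul₀ hs.ne']
      abel
    rw [h4, norm_neg, norm_smul, norm_mul, Real.norm_eq_abs (V _ _ - _), mul_left_comm]
    gcongr
  have hsum := hdiff.add hslope
  rw [zero_add] at hsum
  have hE : Tendsto (fun s : ℝ => (((V (t + s) (x t + s • v) - V t (x t)) / s : ℝ) : EReal))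
      (𝓝[>] 0) (𝓝 ((deriv (fun s => V s (x s)) t : ℝ) : EReal)) := by
    refine (continuous_coe_real_ereal.tendsto _).comp (hsum.congr fun s => ?_)
    rw [div_eq_inv_mul]
    ring
  rw [hE.limsup_eq] at hc
  exact_mod_cast hc

/-! ### Impulse times -/

namespace ImpulseSeq

variable (γ : ImpulseSeq)

lemma τ_strictMono {j k : ℕ} (hjk : j < k) (hk : (k : ℕ∞) ≤ γ.N) : γ.τ j < γ.τ k := by
  induction k, hjk using Nat.le_induction with
  | base => exact γ.τ_lt j (lt_of_lt_of_le (by exact_mod_cast j.lt_succ_self) hk)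
  | succ k hjk ih =>
    have hlt : (k : ℕ∞) < γ.N := lt_of_lt_of_le (by exact_mod_cast k.lt_succ_self) hk
    exact (ih hlt.le).trans (γ.τ_lt k hlt)

lemma τ_mono {j k : ℕ} (hjk : j ≤ k) (hk : (k : ℕ∞) ≤ γ.N) : γ.τ j ≤ γ.τ k := by
  rcases hjk.eq_or_lt with rfl | h
  · exact le_rfl
  · exact (γ.τ_strictMono h hk).le

lemma τ_nonneg {k : ℕ} (hk : (k : ℕ∞) ≤ γ.N) : 0 ≤ γ.τ k :=
  γ.τ_zero ▸ γ.τ_mono k.zero_le hk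

lemma next_of_lt {k : ℕ} (hk : (k : ℕ∞) < γ.N) : γ.next k = (γ.τ (k + 1) : ℝ) := if_pos hk

lemma succ_le_of_lt {k : ℕ} (hk : (k : ℕ∞) < γ.N) : ((k + 1 : ℕ) : ℕ∞) ≤ γ.N := by
  push_cast
  exact Order.add_one_le_of_lt hk

/-- `k` is the index of the last impulse time (or `τ₀ = 0`) up to time `t`. -/
structure IsIndex (t : ℝ) (k : ℕ) : Prop where
  le_N : (k : ℕ∞) ≤ γ.N
  τ_le : γ.τ k ≤ t
  lt_next : (t : EReal) < γ.next k

/-- Without such an index, induction would place infinitely many impulses before t, against the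
absence of finite limit points. -/
lemma exists_isIndex {t : ℝ} (ht : 0 ≤ t) : ∃ k, γ.IsIndex t k := by
  by_contra! hno
  have hstep : ∀ k : ℕ, (k : ℕ∞) ≤ γ.N → γ.τ k ≤ t → (k : ℕ∞) < γ.N ∧ γ.τ (k + 1) ≤ t := by
    intro k hk hkt
    by_cases hN : (k : ℕ∞) < γ.N
    · refine ⟨hN, ?_⟩
      by_contra! hlt
      exact hno k ⟨hk, hkt, by rw [γ.next_of_lt hN]; exact_mod_cast hlt⟩
    · exact absurd ⟨hk, hkt, by simp [next, hN]⟩ (hno k)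
  have hall : ∀ k : ℕ, (k : ℕ∞) ≤ γ.N ∧ γ.τ k ≤ t := by
    intro k
    induction k with
    | zero => exact ⟨by simp, by rwa [γ.τ_zero]⟩
    | succ k ih =>
      obtain ⟨h1, h2⟩ := hstep k ih.1 ih.2
      exact ⟨γ.succ_le_of_lt h1, h2⟩
  have htop : γ.N = ⊤ := ENat.eq_top_iff_forall_ge.2 fun k => (hall k).1
  obtain ⟨k, hk⟩ := ((γ.τ_tendsto htop).eventually_gt_atTop t).exists
  exact absurd (hall k).2 hk.not_ge

variable {γ}

lemma IsIndex.le_of_τ_le {t : ℝ} {j k : ℕ} (h : γ.IsIndex t k) (hj : (j : ℕ∞) ≤ γ.N)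
    (hjt : γ.τ j ≤ t) : j ≤ k := by
  by_contra! hlt
  have hkN : (k : ℕ∞) < γ.N := lt_of_lt_of_le (by exact_mod_cast hlt) hj
  have h1 := h.lt_next
  rw [γ.next_of_lt hkN] at h1
  have h2 : t < γ.τ (k + 1) := by exact_mod_cast h1
  exact absurd (γ.τ_mono (Nat.succ_le_of_lt hlt) hj) (by simpa using hjt.trans_lt h2)

lemma IsIndex.lt_τ {t : ℝ} {j k : ℕ} (h : γ.IsIndex t k) (hj : (j : ℕ∞) ≤ γ.N) (hkj : k < j) :
    t < γ.τ j := by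
  by_contra! hle
  exact absurd (h.le_of_τ_le hj hle) hkj.not_ge

lemma IsIndex.mono {s t : ℝ} {j k : ℕ} (hj : γ.IsIndex s j) (hk : γ.IsIndex t k) (hst : s ≤ t) :
    j ≤ k :=
  hk.le_of_τ_le hj.le_N (hj.τ_le.trans hst)

lemma IsIndex.times_inter_Ioc {s t : ℝ} {j k : ℕ} (hj : γ.IsIndex s j) (hk : γ.IsIndex t k) :
    γ.times ∩ Ioc s t = γ.τ '' (Finset.Ioc j k : Set ℕ) := by
  ext r
  constructor
  · rintro ⟨⟨i, -, hiN, rfl⟩, hsi, hit⟩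
    refine ⟨i, ?_, rfl⟩
    rw [Finset.coe_Ioc]
    refine ⟨?_, hk.le_of_τ_le hiN hit⟩
    by_contra! hle
    exact absurd ((γ.τ_mono hle hj.le_N).trans hj.τ_le) hsi.not_ge
  · rintro ⟨i, hi, rfl⟩
    rw [Finset.coe_Ioc] at hi
    have hiN : (i : ℕ∞) ≤ γ.N := le_trans (by exact_mod_cast hi.2) hk.le_N
    exact ⟨⟨i, by have := hi.1; omega, hiN, rfl⟩, hj.lt_τ hiN hi.1,
      (γ.τ_mono hi.2 hk.le_N).trans hk.τ_le⟩

lemma IsIndex.count_eq {s t : ℝ} {j k : ℕ} (hj : γ.IsIndex s j) (hk : γ.IsIndex t k) :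
    γ.count s t = k - j := by
  rw [count, hj.times_inter_Ioc hk, InjOn.ncard_image, ncard_coe_finset, Nat.card_Ioc]
  have h : ∀ i ∈ (Finset.Ioc j k : Set ℕ), (i : ℕ∞) ≤ γ.N := by
    intro i hi
    rw [Finset.coe_Ioc] at hi
    exact le_trans (by exact_mod_cast hi.2) hk.le_N
  intro i hi i' hi' heq
  rcases lt_trichotomy i i' with hlt | rfl | hlt
  · exact absurd heq (γ.τ_strictMono hlt (h _ hi')).ne
  · rfl
  · exact absurd heq (γ.τ_strictMono hlt (h _ hi)).ne'

lemma finite_times_inter_Ioc {s t : ℝ} (hs : 0 ≤ s) (ht : 0 ≤ t) :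
    (γ.times ∩ Ioc s t).Finite := by
  obtain ⟨j, hj⟩ := γ.exists_isIndex hs
  obtain ⟨k, hk⟩ := γ.exists_isIndex ht
  rw [hj.times_inter_Ioc hk]
  exact (Finset.finite_toSet _).image _

lemma notMem_times {s : ℝ} {k : ℕ} (hk : (k : ℕ∞) ≤ γ.N) (hks : γ.τ k < s)
    (hs : (s : EReal) < γ.next k) : s ∉ γ.times := by
  rintro ⟨i, -, hiN, rfl⟩
  have hle := IsIndex.le_of_τ_le ⟨hk, hks.le, hs⟩ hiN le_rfl
  exact absurd (γ.τ_mono hle hk) hks.not_ge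

end ImpulseSeq

/-! ### Gain functions -/

/-- Nondecreasing functions on `[0,∞)` that vanish at zero and are continuous there. -/
structure IsGain (R : ℝ → ℝ) : Prop where
  mono : MonotoneOn R (Ici 0)
  zero : R 0 = 0
  tendsto : Tendsto R (𝓝[≥] 0) (𝓝 0)

namespace IsGain

variable {R R' : ℝ → ℝ}

lemma nonneg (hR : IsGain R) {r : ℝ} (hr : 0 ≤ r) : 0 ≤ R r :=
  hR.zero ▸ hR.mono (le_refl (0 : ℝ)) hr hr

lemma tendsto_nhdsGE (hR : IsGain R) : Tendsto R (𝓝[≥] 0) (𝓝[≥] 0) :=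
  tendsto_nhdsWithin_iff.2 ⟨hR.tendsto, by
    filter_upwards [self_mem_nhdsWithin] with r hr using hR.nonneg hr⟩

lemma comp (hR : IsGain R) (hR' : IsGain R') : IsGain fun r => R (R' r) where
  mono _ hr _ hr' h := hR.mono (hR'.nonneg hr) (hR'.nonneg hr') (hR'.mono hr hr' h)
  zero := by rw [hR'.zero, hR.zero]
  tendsto := hR.tendsto.comp hR'.tendsto_nhdsGE

lemma max (hR : IsGain R) (hR' : IsGain R') : IsGain fun r => max (R r) (R' r) where
  mono _ hr _ hr' h := max_le_max (hR.mono hr hr' h) (hR'.mono hr hr' h)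
  zero := by rw [hR.zero, hR'.zero, max_self]
  tendsto := by simpa using hR.tendsto.max hR'.tendsto

lemma id : IsGain fun r => r :=
  ⟨fun _ _ _ _ h => h, rfl, tendsto_id.mono_left nhdsWithin_le_nhds⟩

end IsGain

lemma IsKInf.isGain {α : ℝ → ℝ} (h : IsKInf α) : IsGain α :=
  ⟨h.2.1.monotoneOn, h.2.2.1, by simpa [ContinuousWithinAt, h.2.2.1] using h.1 0 self_mem_Ici⟩

/-- Suprema of an increasing family of sets that shrinks to `{0}` form a gain function. -/
lemma isGain_sSup {S : ℝ → Set ℝ} (h0 : ∀ v, 0 ≤ v → 0 ∈ S v)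
    (hbdd : ∀ v, 0 ≤ v → BddAbove (S v)) (hmono : ∀ v v', 0 ≤ v → v ≤ v' → S v ⊆ S v')
    (hsmall : ∀ ε, 0 < ε → ∃ η, 0 < η ∧ ∀ v, 0 ≤ v → v < η → ∀ w ∈ S v, w ≤ ε) :
    IsGain fun v => sSup (S v) := by
  have hnn : ∀ v, 0 ≤ v → 0 ≤ sSup (S v) := fun v hv => le_csSup (hbdd v hv) (h0 v hv)
  refine ⟨fun v hv v' hv' h => csSup_le_csSup (hbdd v' hv') ⟨0, h0 v hv⟩ (hmono v v' hv h),
    le_antisymm ?_ (hnn 0 le_rfl), ?_⟩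
  · refine le_of_forall_pos_le_add fun ε hε => ?_
    obtain ⟨η, hη, h⟩ := hsmall ε hε
    rw [zero_add]
    exact csSup_le ⟨0, h0 0 le_rfl⟩ (h 0 le_rfl hη)
  · rw [Metric.tendsto_nhds]
    intro ε hε
    obtain ⟨η, hη, h⟩ := hsmall (ε / 2) (half_pos hε)
    filter_upwards [self_mem_nhdsWithin, mem_nhdsWithin_of_mem_nhds (gt_mem_nhds hη)] with v hv hvη
    rw [Real.dist_eq, sub_zero, abs_of_nonneg (hnn v hv)]
    exact (csSup_le ⟨0, h0 v hv⟩ (h v hv hvη)).trans_lt (half_lt_self hε)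

/-- The running maximum of `α` over `[0, v]`. -/
noncomputable def runningMax (α : ℝ → ℝ) (v : ℝ) : ℝ := sSup (α '' Icc 0 v)

lemma bddAbove_image_Icc {α : ℝ → ℝ} (hα : ContinuousOn α (Ici 0)) (v : ℝ) :
    BddAbove (α '' Icc 0 v) :=
  (isCompact_Icc.image_of_continuousOn (hα.mono Icc_subset_Ici_self)).bddAbove

lemma le_runningMax {α : ℝ → ℝ} (hα : ContinuousOn α (Ici 0)) {w v : ℝ} (hw : 0 ≤ w)
    (hwv : w ≤ v) : α w ≤ runningMax α v :=
  le_csSup (bddAbove_image_Icc hα v) ⟨w, ⟨hw, hwv⟩, rfl⟩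

lemma isGain_runningMax {α : ℝ → ℝ} (hα : ContinuousOn α (Ici 0)) (h0 : α 0 = 0) :
    IsGain (runningMax α) := by
  refine isGain_sSup (fun v hv => ⟨0, ⟨le_rfl, hv⟩, h0⟩) (fun v _ => bddAbove_image_Icc hα v)
    (fun v v' _ h => image_mono (Icc_subset_Icc_right h)) fun ε hε => ?_
  have h1 : Tendsto α (𝓝[≥] 0) (𝓝 0) := by
    simpa [ContinuousWithinAt, h0] using hα 0 self_mem_Ici
  have h2 := h1.eventually (gt_mem_nhds hε)
  rw [eventually_nhdsWithin_iff] at h2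
  obtain ⟨η, hη, h⟩ := exists_Ico_subset_of_mem_nhds h2 ⟨1, one_pos⟩
  refine ⟨η, hη, ?_⟩
  rintro v - hv _ ⟨w, hw, rfl⟩
  exact (h ⟨hw.1, hw.2.trans_lt hv⟩ hw.1).le

/-- The generalized inverse `y ↦ sup {z ≥ 0 : α z ≤ y}`. -/
noncomputable def generalizedInverse (α : ℝ → ℝ) (y : ℝ) : ℝ := sSup {z | 0 ≤ z ∧ α z ≤ y}

lemma IsKInf.bddAbove_setOf_le {α : ℝ → ℝ} (h : IsKInf α) (y : ℝ) :
    BddAbove {z | 0 ≤ z ∧ α z ≤ y} := by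
  obtain ⟨_, ⟨z, hz, rfl⟩, hzy⟩ := not_bddAbove_iff.1 h.2.2.2 y
  refine ⟨z, fun w hw => ?_⟩
  by_contra! hlt
  linarith [h.2.1 hz hw.1 hlt, hw.2]

/-- Used to pass from a bound on φ₁(h) to one on h; a gain function is enough here, so continuity of
the inverse is never needed. -/
lemma IsKInf.le_generalizedInverse {α : ℝ → ℝ} (h : IsKInf α) {z y : ℝ} (hz : 0 ≤ z)
    (hzy : α z ≤ y) : z ≤ generalizedInverse α y :=
  le_csSup (h.bddAbove_setOf_le y) ⟨hz, hzy⟩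

lemma IsKInf.isGain_generalizedInverse {α : ℝ → ℝ} (h : IsKInf α) :
    IsGain (generalizedInverse α) := by
  refine isGain_sSup (fun v hv => ⟨le_rfl, h.2.2.1.trans_le hv⟩) (fun v _ => h.bddAbove_setOf_le v)
    (fun v v' _ hv w hw => ⟨hw.1, hw.2.trans hv⟩) fun ε hε => ⟨α ε, ?_, fun v _ hv w hw => ?_⟩
  · exact h.2.2.1 ▸ h.2.1 self_mem_Ici (mem_Ici.2 hε.le) hε
  · by_contra! hlt
    linarith [h.2.1 (mem_Ici.2 hε.le) hw.1 hlt, hw.2]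

/-! ### Decay measured by `G` -/

/-- `w` vanishes, or `w` and `v` are positive and `G w ≤ G v - a`. -/
def DecaysBy (G : ℝ → ℝ) (w v a : ℝ) : Prop := w ≤ 0 ∨ 0 < w ∧ 0 < v ∧ G w + a ≤ G v

namespace DecaysBy

variable {G : ℝ → ℝ} {w v z a b : ℝ}

lemma trans (h : DecaysBy G w v a) (h' : DecaysBy G v z b) : DecaysBy G w z (a + b) := by
  rcases h with h | ⟨hw, hv, h⟩
  · exact Or.inl h
  · rcases h' with h' | ⟨-, hz, h'⟩
    · exact absurd hv h'.not_gt
    · exact Or.inr ⟨hw, hz, by linarith⟩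

lemma weaken (h : DecaysBy G w v a) (hba : b ≤ a) : DecaysBy G w v b :=
  h.imp_right fun ⟨hw, hv, h⟩ => ⟨hw, hv, by linarith⟩

lemma le (hG : StrictMonoOn G (Ioi 0)) (h : DecaysBy G w v a) (ha : 0 ≤ a) (hv : 0 ≤ v) :
    w ≤ v := by
  rcases h with h | ⟨hw, hv, h⟩
  · exact h.trans hv
  · exact (hG.le_iff_le hw hv).1 (by linarith)

lemma mono_right (hG : StrictMonoOn G (Ioi 0)) (h : DecaysBy G w v a) (hvz : v ≤ z) :
    DecaysBy G w z a :=
  h.imp_right fun ⟨hw, hv, h⟩ =>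
    ⟨hw, hv.trans_le hvz, h.trans (hG.monotoneOn hv (hv.trans_le hvz) hvz)⟩

lemma mono_left (hG : StrictMonoOn G (Ioi 0)) (h : DecaysBy G w v a) (hzw : z ≤ w) :
    DecaysBy G z v a := by
  rcases le_or_gt z 0 with hz | hz
  · exact Or.inl hz
  · rcases h with h | ⟨hw, hv, h⟩
    · exact Or.inl (hzw.trans h)
    · exact Or.inr ⟨hz, hv, by linarith [hG.monotoneOn hz hw hzw]⟩

end DecaysBy

/-- `sup {w : G w ≤ G v + P}`. -/
noncomputable def growthBound (G : ℝ → ℝ) (P v : ℝ) : ℝ := sSup {w | 0 ≤ w ∧ DecaysBy G w v (-P)}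

lemma bddAbove_setOf_decaysBy {G : ℝ → ℝ} (hG : StrictMonoOn G (Ioi 0))
    (htop : ∀ C, ∃ w, 0 < w ∧ C < G w) (a v : ℝ) : BddAbove {w | 0 ≤ w ∧ DecaysBy G w v a} := by
  obtain ⟨z, hz, hGz⟩ := htop (G v - a)
  refine ⟨z, fun w hw => ?_⟩
  rcases hw.2 with h | ⟨hw, hv, h⟩
  · exact h.trans hz.le
  · exact (hG.le_iff_le hw hz).1 (by linarith)

lemma le_growthBound {G : ℝ → ℝ} (hG : StrictMonoOn G (Ioi 0))
    (htop : ∀ C, ∃ w, 0 < w ∧ C < G w) {P w v : ℝ} (hw : 0 ≤ w) (h : DecaysBy G w v (-P)) :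
    w ≤ growthBound G P v :=
  le_csSup (bddAbove_setOf_decaysBy hG htop _ v) ⟨hw, h⟩

/-- Unboundedness of G above makes the supremum finite; G → -∞ at zero makes it small for small v.
-/
lemma isGain_growthBound {G : ℝ → ℝ} (hG : StrictMonoOn G (Ioi 0))
    (htop : ∀ C, ∃ w, 0 < w ∧ C < G w)
    (hbot : ∀ C, ∃ ε, 0 < ε ∧ ∀ w, 0 < w → w ≤ ε → G w < C) (P : ℝ) :
    IsGain (growthBound G P) := by
  refine isGain_sSup (fun v _ => ⟨le_rfl, Or.inl le_rfl⟩)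
    (fun v _ => bddAbove_setOf_decaysBy hG htop _ v)
    (fun v v' _ hv w hw => ⟨hw.1, hw.2.mono_right hG hv⟩) fun ε hε => ?_
  obtain ⟨η, hη, h⟩ := hbot (G ε - P)
  refine ⟨η, hη, fun v _ hv w hw => ?_⟩
  rcases hw.2 with h' | ⟨hw, hv0, h'⟩
  · exact h'.trans hε.le
  · exact (hG.le_iff_le hw hε).1 (by linarith [h v hv0 hv.le])

/-- The largest `w ≤ A v` that decays by `κ s - C` from `v`. -/
noncomputable def decayBound (G A : ℝ → ℝ) (κ C v s : ℝ) : ℝ :=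
  sSup {w | 0 ≤ w ∧ w ≤ A v ∧ DecaysBy G w v (κ * s - C)}

section DecayBound

variable {G A : ℝ → ℝ} {κ C : ℝ}

lemma bddAbove_decayBound (v s : ℝ) :
    BddAbove {w | 0 ≤ w ∧ w ≤ A v ∧ DecaysBy G w v (κ * s - C)} := ⟨A v, fun _ hw => hw.2.1⟩

lemma le_decayBound {w v s : ℝ} (hw : 0 ≤ w) (hwA : w ≤ A v)
    (h : DecaysBy G w v (κ * s - C)) : w ≤ decayBound G A κ C v s :=
  le_csSup (bddAbove_decayBound v s) ⟨hw, hwA, h⟩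

lemma decayBound_nonneg (hA : IsGain A) {v : ℝ} (hv : 0 ≤ v) (s : ℝ) :
    0 ≤ decayBound G A κ C v s :=
  le_decayBound le_rfl (hA.nonneg hv) (Or.inl le_rfl)

lemma decayBound_le (hA : IsGain A) {v : ℝ} (hv : 0 ≤ v) (s : ℝ) :
    decayBound G A κ C v s ≤ A v :=
  csSup_le ⟨0, le_rfl, hA.nonneg hv, Or.inl le_rfl⟩ fun _ hw => hw.2.1

lemma decayBound_mono (hG : StrictMonoOn G (Ioi 0)) (hA : IsGain A) (hκ : 0 ≤ κ) {v v' s s' : ℝ}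
    (hv : 0 ≤ v) (hvv : v ≤ v') (hss : s' ≤ s) :
    decayBound G A κ C v s ≤ decayBound G A κ C v' s' :=
  csSup_le_csSup (bddAbove_decayBound v' s') ⟨0, le_rfl, hA.nonneg hv, Or.inl le_rfl⟩
    fun _ hw => ⟨hw.1, hw.2.1.trans (hA.mono hv (hv.trans hvv) hvv),
      (hw.2.2.mono_right hG hvv).weaken (by gcongr)⟩

/-- For large s the required value of G lies below G(ε/2), which forces w ≤ ε/2. If G is bounded
near zero, only the alternative w ≤ 0 eventually survives: decay in finite time. -/
lemma tendsto_decayBound (hG : StrictMonoOn G (Ioi 0)) (hA : IsGain A) (hκ : 0 < κ) {v : ℝ}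
    (hv : 0 ≤ v) : Tendsto (decayBound G A κ C v) atTop (𝓝[≥] 0) := by
  refine tendsto_nhdsWithin_iff.2 ⟨?_, Eventually.of_forall fun s => decayBound_nonneg hA hv s⟩
  rw [Metric.tendsto_nhds]
  intro ε hε
  filter_upwards [eventually_gt_atTop ((G v - G (ε / 2) + C) / κ)] with s hs
  rw [div_lt_iff₀ hκ] at hs
  rw [Real.dist_eq, sub_zero, abs_of_nonneg (decayBound_nonneg hA hv s)]
  refine lt_of_le_of_lt (csSup_le ⟨0, le_rfl, hA.nonneg hv, Or.inl le_rfl⟩ fun w hw => ?_)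
    (half_lt_self hε)
  rcases hw.2.2 with h | ⟨hw, -, h⟩
  · linarith
  · exact (hG.le_iff_le hw (half_pos hε)).1 (by linarith)

end DecayBound

/-- Strong input-to-state stability from an estimate, along all solutions, of functions `V l`
between `φ₁ ∘ h` and `φ₂ ∘ hᵒ`. -/
theorem stronglyISS_of_decaysBy {n m : ℕ} {Λ : Type*} (Sys : Λ → ImpulsiveSystem n m)
    (ho h : ℝ → EuclideanSpace ℝ (Fin n) → ℝ) (hho : IsMeasuringFun ho) (hh : IsMeasuringFun h)
    (V : Λ → ℝ → EuclideanSpace ℝ (Fin n) → ℝ) {φ₁ φ₂ : ℝ → ℝ} (hφ₁ : IsKInf φ₁) (hφ₂ : IsKInf φ₂)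
    (hV : ∀ l t, 0 ≤ t → ∀ ξ, φ₁ (h t ξ) ≤ V l t ξ ∧ V l t ξ ≤ φ₂ (ho t ξ))
    {G A R : ℝ → ℝ} {κ C : ℝ} (hG : StrictMonoOn G (Ioi 0)) (hA : IsGain A) (hR : IsGain R)
    (hκ : 0 < κ)
    (hbound : ∀ l t₀, 0 ≤ t₀ → ∀ x₀ u, IsInput u → ∀ T x,
      (Sys l).IsSolution t₀ x₀ u T x → ∀ t, t₀ ≤ t → (t : EReal) < T →
        V l t (x t) ≤ R (inputNorm (Sys l).γ u (Ioc t₀ t)).toReal ∨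
        V l t (x t) ≤ A (V l t₀ x₀) ∧
          DecaysBy G (V l t (x t)) (V l t₀ x₀) (κ * (t - t₀ + ((Sys l).γ.count t₀ t : ℝ)) - C)) :
    StronglyISS Sys ho h := by
  set Q := generalizedInverse φ₁
  have hQ : IsGain Q := hφ₁.isGain_generalizedInverse
  have hg₂ : IsGain φ₂ := hφ₂.isGain
  have hnn : ∀ r s, 0 ≤ r → 0 ≤ decayBound G A κ C (φ₂ r) s := fun r s hr =>
    decayBound_nonneg hA (hg₂.nonneg hr) s
  have hle : ∀ r s, 0 ≤ r → Q (decayBound G A κ C (φ₂ r) s) ≤ Q (A (φ₂ r)) := fun r s hr =>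
    hQ.mono (hnn r s hr) (hA.nonneg (hg₂.nonneg hr)) (decayBound_le hA (hg₂.nonneg hr) s)
  have hQA := hQ.comp (hA.comp hg₂)
  have hz : Q (decayBound G A κ C (φ₂ 0) 0) = 0 :=
    le_antisymm ((hle 0 0 le_rfl).trans_eq hQA.zero) (hQ.nonneg (hnn 0 0 le_rfl))
  -- The cap by A gives continuity at r = 0, and the decay of G gives the limit in s.
  obtain ⟨β, hβ, hβle⟩ := exists_isKL_ge (B := fun r s => Q (decayBound G A κ C (φ₂ r) s))
    (fun s _ r hr r' hr' hrr => hQ.mono (hnn r s hr) (hnn r' s hr')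
      (decayBound_mono hG hA hκ.le (hg₂.nonneg hr) (hg₂.mono hr hr' hrr) le_rfl))
    (fun r hr s _ s' _ hss => hQ.mono (hnn r s' hr) (hnn r s hr)
      (decayBound_mono hG hA hκ.le (hg₂.nonneg hr) le_rfl hss))
    (fun r s hr _ => hQ.nonneg (hnn r s hr)) hz
    (tendsto_of_tendsto_of_tendsto_of_le_of_le' tendsto_const_nhds
      (hQA.tendsto.mono_left (nhdsWithin_mono _ Ioi_subset_Ici_self))
      (by filter_upwards [self_mem_nhdsWithin] with r hr using hQ.nonneg (hnn r 0 (le_of_lt hr)))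
      (by filter_upwards [self_mem_nhdsWithin] with r hr using hle r 0 (le_of_lt hr)))
    (fun r hr => hQ.tendsto.comp (tendsto_decayBound hG hA hκ (hg₂.nonneg hr)))
  have hQR := hQ.comp hR
  obtain ⟨ρ, hρ, hρle⟩ := exists_isKInf_ge hQR.mono hQR.zero
    (hQR.tendsto.mono_left (nhdsWithin_mono _ Ioi_subset_Ici_self))
  refine ⟨β, ρ, hβ, hρ, fun l t₀ ht₀ x₀ u hu T x hx t htt htT => ?_⟩
  have ht : 0 ≤ t := ht₀.trans htt
  have hs : 0 ≤ t - t₀ + ((Sys l).γ.count t₀ t : ℝ) := by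
    have := sub_nonneg.2 htt
    positivity
  set r := (inputNorm (Sys l).γ u (Ioc t₀ t)).toReal
  have hr : 0 ≤ r := ENNReal.toReal_nonneg
  have hVnn : ∀ s, 0 ≤ s → ∀ ξ, 0 ≤ V l s ξ := fun s hs ξ =>
    (hφ₁.isGain.nonneg (hh s hs ξ)).trans (hV l s hs ξ).1
  have hβnn := (hQ.nonneg (hnn _ _ (hho t₀ ht₀ x₀))).trans (hβle _ _ (hho t₀ ht₀ x₀) hs)
  have hρnn : 0 ≤ ρ r := hρ.isGain.nonneg hr
  have hhV : ∀ y, V l t (x t) ≤ y → h t (x t) ≤ Q y := fun y hy =>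
    hφ₁.le_generalizedInverse (hh t ht _) ((hV l t ht _).1.trans hy)
  rcases hbound l t₀ ht₀ x₀ u hu T x hx.1 t htt htT with hb | ⟨hbA, hb⟩
  · have := (hhV _ hb).trans (hρle r hr)
    linarith
  · have hv₀ := hVnn t₀ ht₀ x₀
    have h1 := (le_decayBound (hVnn t ht _) hbA hb).trans
      (decayBound_mono hG hA hκ.le hv₀ (hV l t₀ ht₀ x₀).2 le_rfl)
    have := (hhV _ h1).trans (hβle _ _ (hho t₀ ht₀ x₀) hs)
    linarith

/-! ### Estimates for functions that flow and jump -/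

/-- A function `W` on `[t₀, t]` with left values `L k` at the impulse times `τ k`, that obeys a flow
estimate between impulses and, at impulses, is bounded by `α` and `p`. -/
structure HybridBound (γ : ImpulseSeq) (G ψ α W : ℝ → ℝ) (L : ℕ → ℝ) (t₀ t c p : ℝ) : Prop where
  nonneg : ∀ s ∈ Icc t₀ t, 0 ≤ W s
  left_nonneg : ∀ k : ℕ, 1 ≤ k → (k : ℕ∞) ≤ γ.N → t₀ < γ.τ k → γ.τ k ≤ t → 0 ≤ L k
  flow : ∀ (k : ℕ) (a b : ℝ), (k : ℕ∞) ≤ γ.N → γ.τ k ≤ a → t₀ ≤ a → a ≤ b → b ≤ t →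
    (b : EReal) < γ.next k → FlowBound G ψ W c a b (W b)
  flow_left : ∀ (k : ℕ) (a : ℝ), (k : ℕ∞) < γ.N → γ.τ k ≤ a → t₀ ≤ a → a < γ.τ (k + 1) →
    γ.τ (k + 1) ≤ t → FlowBound G ψ W c a (γ.τ (k + 1)) (L (k + 1))
  jump : ∀ k : ℕ, 1 ≤ k → (k : ℕ∞) ≤ γ.N → t₀ < γ.τ k → γ.τ k ≤ t → W (γ.τ k) ≤ max (α (L k)) p
  jump_of_le : ∀ k : ℕ, 1 ≤ k → (k : ℕ∞) ≤ γ.N → t₀ < γ.τ k → γ.τ k ≤ t → c ≤ L k →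
    W (γ.τ k) ≤ α (L k)

/-- When the flow decreases G, a restart from a value at most c ends at most at c, so only the start
at `a` matters. -/
lemma FlowBound.decaysBy_of_nonneg {G ψ W : ℝ → ℝ} {a b c w : ℝ} (hG : StrictMonoOn G (Ioi 0))
    (hψ : ∀ r, a ≤ r → 0 ≤ ψ r) (h : FlowBound G ψ W c a b w) :
    w ≤ c ∨ DecaysBy G w (W a) (∫ r in a..b, ψ r) := by
  rcases h with h | ⟨s, hs, h1, h2, h3⟩
  · exact Or.inl h
  rcases le_or_gt w 0 with hw | hw
  · exact Or.inr (Or.inl hw)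
  rcases h1 with rfl | h1
  · exact Or.inr (Or.inr ⟨hw, h2, h3⟩)
  · have : 0 ≤ ∫ r in s..b, ψ r :=
      intervalIntegral.integral_nonneg hs.2 fun r hr => hψ r (hs.1.trans hr.1)
    exact Or.inl (((hG.le_iff_le hw h2).1 (by linarith)).trans h1)

/-- Here the flow may climb again from level c, hence the maximum with c. -/
lemma FlowBound.decaysBy_of_le {G ψ W : ℝ → ℝ} {a b c w P : ℝ} (hG : StrictMonoOn G (Ioi 0))
    (hψ : ∀ s ∈ Icc a b, -P ≤ ∫ r in s..b, ψ r) (h : FlowBound G ψ W c a b w) :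
    w ≤ c ∨ DecaysBy G w (max (W a) c) (-P) := by
  rcases h with h | ⟨s, hs, h1, h2, h3⟩
  · exact Or.inl h
  rcases le_or_gt w 0 with hw | hw
  · exact Or.inr (Or.inl hw)
  have hle : W s ≤ max (W a) c := by
    rcases h1 with rfl | h1
    · exact le_max_left _ _
    · exact h1.trans (le_max_right _ _)
  refine Or.inr (DecaysBy.mono_right hG (v := W s) (Or.inr ⟨hw, h2, ?_⟩) hle)
  linarith [hψ s hs]

section MinDwell

variable {ψ : ℝ → ℝ} {θ M : ℝ}

lemma natCast_mul_le_integral (hθ : 0 < θ) (hψ : ∀ r, 0 ≤ r → 0 ≤ ψ r)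
    (hint : ∀ a b, 0 ≤ a → 0 ≤ b → IntervalIntegrable ψ volume a b)
    (hM : ∀ a, 0 ≤ a → M ≤ ∫ r in a..a + θ, ψ r) (q : ℕ) :
    ∀ {a b : ℝ}, 0 ≤ a → a + q * θ ≤ b → q * M ≤ ∫ r in a..b, ψ r := by
  induction q with
  | zero =>
    intro a b ha hab
    simp only [Nat.cast_zero, zero_mul, add_zero] at hab ⊢
    exact intervalIntegral.integral_nonneg hab fun r hr => hψ r (ha.trans hr.1)
  | succ q ih =>
    intro a b ha hab
    push_cast at hab ⊢
    have h1 := ih (a := a + θ) (b := b) (by positivity) (by linarith)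
    have hb : 0 ≤ b := by
      have : 0 ≤ a + (q + 1) * θ := by positivity
      linarith
    rw [← intervalIntegral.integral_add_adjacent_intervals (hint a (a + θ) ha (by positivity))
      (hint (a + θ) b (by positivity) hb)]
    linarith [hM a ha]

/-- Rounding to whole intervals of length θ costs at most one of them, that is, M. -/
lemma mul_sub_one_le_integral (hθ : 0 < θ) (hM0 : 0 < M) (hψ : ∀ r, 0 ≤ r → 0 ≤ ψ r)
    (hint : ∀ a b, 0 ≤ a → 0 ≤ b → IntervalIntegrable ψ volume a b)
    (hM : ∀ a, 0 ≤ a → M ≤ ∫ r in a..a + θ, ψ r) {a b : ℝ} (ha : 0 ≤ a) (hab : a ≤ b) :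
    M / θ * (b - a) - M ≤ ∫ r in a..b, ψ r := by
  have hx : 0 ≤ (b - a) / θ := div_nonneg (sub_nonneg.2 hab) hθ.le
  have h1 := Nat.floor_le hx
  rw [le_div_iff₀ hθ] at h1
  have h2 := natCast_mul_le_integral hθ hψ hint hM ⌊(b - a) / θ⌋₊ (b := b) ha (by linarith)
  have h3 := Nat.lt_floor_add_one ((b - a) / θ)
  have h4 : M / θ * (b - a) = (b - a) / θ * M := by ring
  nlinarith

/-- With q ≥ 1 whole intervals, qM - S ≥ q(M - S), and (b - a)/θ + 1 ≤ q + 2 ≤ 4q. The net gain thus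
pays for both the elapsed time and one impulse. -/
lemma le_integral_sub (hθ : 0 < θ) (hψ : ∀ r, 0 ≤ r → 0 ≤ ψ r)
    (hint : ∀ a b, 0 ≤ a → 0 ≤ b → IntervalIntegrable ψ volume a b)
    (hM : ∀ a, 0 ≤ a → M ≤ ∫ r in a..a + θ, ψ r) {S : ℝ} (hS : 0 ≤ S) (hSM : S < M) {a b : ℝ}
    (ha : 0 ≤ a) (hab : θ ≤ b - a) :
    (M - S) / 4 * ((b - a) / θ + 1) ≤ (∫ r in a..b, ψ r) - S := by
  have hx : 1 ≤ (b - a) / θ := (one_le_div hθ).2 hab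
  have h1 := Nat.floor_le (zero_le_one.trans hx)
  rw [le_div_iff₀ hθ] at h1
  have h2 := natCast_mul_le_integral hθ hψ hint hM ⌊(b - a) / θ⌋₊ (b := b) ha (by linarith)
  have h3 := Nat.lt_floor_add_one ((b - a) / θ)
  have h4 : (1 : ℝ) ≤ ⌊(b - a) / θ⌋₊ := by
    exact_mod_cast Nat.le_floor (by exact_mod_cast hx)
  set q : ℝ := ((⌊(b - a) / θ⌋₊ : ℕ) : ℝ)
  have h5 : S ≤ q * S := by nlinarith
  have h6 : (M - S) * (((b - a) / θ + 1) / 4) ≤ (M - S) * q := by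
    gcongr
    · linarith
  linarith

/-- The bound for a minimum dwell time: the flow decreases `G` by at least `M` over each interval of
length `θ`, and a jump increases it by at most `S < M`. -/
theorem HybridBound.le_of_minDwell {γ : ImpulseSeq} {G α W : ℝ → ℝ} {L : ℕ → ℝ}
    {t₀ t c p S : ℝ} (H : HybridBound γ G ψ α W L t₀ t c p) (hG : StrictMonoOn G (Ioi 0))
    (hα : ContinuousOn α (Ici 0)) (hα0 : IsPosDefFun α) (hθ : 0 < θ) (hψ : ∀ r, 0 ≤ r → 0 ≤ ψ r)
    (hint : ∀ a b, 0 ≤ a → 0 ≤ b → IntervalIntegrable ψ volume a b)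
    (hM : ∀ a, 0 ≤ a → M ≤ ∫ r in a..a + θ, ψ r) (hS : 0 ≤ S) (hSM : S < M)
    (hjump : ∀ a, 0 < a → G (α a) ≤ G a + S) (hγ : γ.HasMinDwell θ) (hc : 0 ≤ c)
    (ht₀ : 0 ≤ t₀) (htt : t₀ ≤ t) {κ ρ : ℝ} (hκ : 0 ≤ κ) (hκ1 : κ ≤ (M - S) / 4)
    (hκ2 : κ ≤ (M - S) / 4 / θ) (hcρ : c ≤ ρ) (hpρ : p ≤ ρ) (hαρ : runningMax α c ≤ ρ) :
    W t ≤ max ρ (runningMax α ρ) ∨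
      W t ≤ max (W t₀) (runningMax α (W t₀)) ∧
        DecaysBy G (W t) (W t₀) (κ * (t - t₀ + (γ.count t₀ t : ℝ)) - (κ + 2 * M + S)) := by
  have hM0 : 0 < M := hS.trans_lt hSM
  have hκM : κ ≤ M / θ := hκ2.trans (by gcongr; linarith)
  have hint_ge : ∀ {a b}, 0 ≤ a → a ≤ b → κ * (b - a) - M ≤ ∫ r in a..b, ψ r := by
    intro a b ha hab
    refine le_trans ?_ (mul_sub_one_le_integral hθ hM0 hψ hint hM ha hab)
    have := mul_le_mul_of_nonneg_right hκM (sub_nonneg.2 hab)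
    linarith
  have hint_nn : ∀ {a b}, 0 ≤ a → a ≤ b → 0 ≤ ∫ r in a..b, ψ r := fun ha hab =>
    intervalIntegral.integral_nonneg hab fun r hr => hψ r (ha.trans hr.1)
  have hgain : ∀ {a b}, 0 ≤ a → θ ≤ b - a → κ * (b - a + 1) ≤ (∫ r in a..b, ψ r) - S := by
    intro a b ha hab
    refine le_trans ?_ (le_integral_sub hθ hψ hint hM hS hSM ha hab)
    have := mul_le_mul_of_nonneg_right hκ2 (hθ.le.trans hab)
    have h2 : (M - S) / 4 * ((b - a) / θ + 1) = (M - S) / 4 / θ * (b - a) + (M - S) / 4 := by ring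
    linarith
  have hv₀ : 0 ≤ W t₀ := H.nonneg t₀ ⟨le_rfl, htt⟩
  obtain ⟨k₀, hk₀⟩ := γ.exists_isIndex ht₀
  obtain ⟨K, hK⟩ := γ.exists_isIndex (ht₀.trans htt)
  have hk₀K := hk₀.mono hK htt
  -- one jump
  have hdrop : ∀ k : ℕ, 1 ≤ k → (k : ℕ∞) ≤ γ.N → t₀ < γ.τ k → γ.τ k ≤ t → c < L k →
      DecaysBy G (W (γ.τ k)) (L k) (-S) := by
    intro k hk hkN hkt hkt' hcL
    have hL0 : 0 < L k := hc.trans_lt hcL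
    refine DecaysBy.mono_left hG (w := α (L k)) (Or.inr ⟨hα0.2 _ hL0, hL0, ?_⟩)
      (H.jump_of_le k hk hkN hkt hkt' hcL.le)
    linarith [hjump _ hL0]
  have hlow : ∀ k : ℕ, 1 ≤ k → (k : ℕ∞) ≤ γ.N → t₀ < γ.τ k → γ.τ k ≤ t → L k ≤ c →
      W (γ.τ k) ≤ ρ := by
    intro k hk hkN hkt hkt' hcL
    refine (H.jump k hk hkN hkt hkt').trans (max_le ?_ hpρ)
    exact (le_runningMax hα (H.left_nonneg k hk hkN hkt hkt') hcL).trans hαρ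
  -- the left values
  have hleft : ∀ k : ℕ, k₀ + 1 ≤ k → k ≤ K → L k ≤ ρ ∨ L k ≤ W t₀ ∧
      DecaysBy G (L k) (W t₀) (κ * (γ.τ k - t₀ + ((k : ℝ) - k₀ - 1)) - M) := by
    intro k hk
    induction k, hk using Nat.le_induction with
    | base =>
      intro hkK
      have hkN : ((k₀ + 1 : ℕ) : ℕ∞) ≤ γ.N := le_trans (by exact_mod_cast hkK) hK.le_N
      have hlt : t₀ < γ.τ (k₀ + 1) := hk₀.lt_τ hkN k₀.lt_succ_self
      have hτt : γ.τ (k₀ + 1) ≤ t := (γ.τ_mono hkK hK.le_N).trans hK.τ_le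
      have hf := H.flow_left k₀ t₀ (lt_of_lt_of_le (by exact_mod_cast k₀.lt_succ_self) hkN)
        hk₀.τ_le le_rfl hlt hτt
      rcases hf.decaysBy_of_nonneg hG (fun r hr => hψ r (ht₀.trans hr)) with h | h
      · exact Or.inl (h.trans hcρ)
      · refine Or.inr ⟨h.le hG (hint_nn ht₀ hlt.le) hv₀, h.weaken ?_⟩
        push_cast
        have := hint_ge ht₀ hlt.le
        linarith
    | succ k hk ih =>
      intro hkK
      have hkN : ((k + 1 : ℕ) : ℕ∞) ≤ γ.N := le_trans (by exact_mod_cast hkK) hK.le_N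
      have hkN' : (k : ℕ∞) < γ.N := lt_of_lt_of_le (by exact_mod_cast k.lt_succ_self) hkN
      have hk1 : 1 ≤ k := by omega
      have hlt : t₀ < γ.τ k := hk₀.lt_τ hkN'.le hk
      have hτ0 : 0 ≤ γ.τ k := γ.τ_nonneg hkN'.le
      have hτt' : γ.τ (k + 1) ≤ t := (γ.τ_mono hkK hK.le_N).trans hK.τ_le
      have hττ : γ.τ k < γ.τ (k + 1) := γ.τ_lt k hkN'
      have hτt : γ.τ k ≤ t := hττ.le.trans hτt'
      have hf := H.flow_left k (γ.τ k) hkN' le_rfl hlt.le hττ hτt'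
      rcases hf.decaysBy_of_nonneg hG (fun r hr => hψ r (hτ0.trans hr)) with h | h
      · exact Or.inl (h.trans hcρ)
      have hWnn : 0 ≤ W (γ.τ k) := H.nonneg _ ⟨hlt.le, hτt⟩
      rcases le_or_gt (L k) c with hLc | hLc
      · exact Or.inl ((h.le hG (hint_nn hτ0 hττ.le) hWnn).trans (hlow k hk1 hkN'.le hlt hτt hLc))
      have hg := hgain hτ0 (hγ k hkN')
      have hd := h.trans (hdrop k hk1 hkN'.le hlt hτt hLc)
      have hLL : L (k + 1) ≤ L k := by
        refine hd.le hG ?_ (hc.trans hLc.le)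
        have : 0 ≤ κ * (γ.τ (k + 1) - γ.τ k + 1) := by
          have := sub_pos.2 hττ
          positivity
        linarith
      rcases ih (by omega) with h' | ⟨h', h''⟩
      · exact Or.inl (hLL.trans h')
      · refine Or.inr ⟨hLL.trans h', (hd.trans h'').weaken ?_⟩
        push_cast
        linarith
  rw [hk₀.count_eq hK]
  rcases hk₀K.eq_or_lt with rfl | hlt
  · have hf := H.flow k₀ t₀ t hk₀.le_N hk₀.τ_le le_rfl htt le_rfl hK.lt_next
    rcases hf.decaysBy_of_nonneg hG (fun r hr => hψ r (ht₀.trans hr)) with h | h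
    · exact Or.inl ((h.trans hcρ).trans (le_max_left _ _))
    · refine Or.inr ⟨(h.le hG (hint_nn ht₀ htt) hv₀).trans (le_max_left _ _), h.weaken ?_⟩
      have := hint_ge ht₀ htt
      simp only [tsub_self, Nat.cast_zero, add_zero]
      linarith
  have hK1 : 1 ≤ K := by omega
  have hKt : t₀ < γ.τ K := hk₀.lt_τ hK.le_N hlt
  have hK0 : 0 ≤ γ.τ K := ht₀.trans hKt.le
  have hf := H.flow K (γ.τ K) t hK.le_N le_rfl hKt.le hK.τ_le le_rfl hK.lt_next
  rcases hf.decaysBy_of_nonneg hG (fun r hr => hψ r (hK0.trans hr)) with h | h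
  · exact Or.inl ((h.trans hcρ).trans (le_max_left _ _))
  have hWle : W t ≤ W (γ.τ K) := h.le hG (hint_nn hK0 hK.τ_le) (H.nonneg _ ⟨hKt.le, hK.τ_le⟩)
  rcases le_or_gt (L K) c with hLc | hLc
  · exact Or.inl ((hWle.trans (hlow K hK1 hK.le_N hKt hK.τ_le hLc)).trans (le_max_left _ _))
  have hWα : W t ≤ α (L K) := hWle.trans (H.jump_of_le K hK1 hK.le_N hKt hK.τ_le hLc.le)
  rcases hleft K hlt le_rfl with h' | ⟨h', h''⟩
  · exact Or.inl ((hWα.trans (le_runningMax hα (hc.trans hLc.le) h')).trans (le_max_right _ _))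
  · refine Or.inr ⟨(hWα.trans (le_runningMax hα (hc.trans hLc.le) h')).trans (le_max_right _ _),
      ((h.trans (hdrop K hK1 hK.le_N hKt hK.τ_le hLc)).trans h'').weaken ?_⟩
    have := hint_ge hK0 hK.τ_le
    rw [Nat.cast_sub hlt.le]
    linarith

end MinDwell

/-- The bound for a maximum dwell time: the flow increases `G` by at most `P` over each interval of
length `θ`, and a jump decreases it by at least `I > P`. -/
theorem HybridBound.le_of_maxDwell {γ : ImpulseSeq} {G φ α W : ℝ → ℝ} {L : ℕ → ℝ}
    {t₀ t c p P I θ : ℝ} (H : HybridBound γ G (fun r => -φ r) α W L t₀ t c p)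
    (hG : StrictMonoOn G (Ioi 0)) (hα0 : IsPosDefFun α) (hθ : 0 < θ)
    (hφ : ∀ r, 0 ≤ r → 0 ≤ φ r)
    (hint : ∀ a b, 0 ≤ a → 0 ≤ b → IntervalIntegrable φ volume a b)
    (hP : ∀ a, 0 ≤ a → ∫ r in a..a + θ, φ r ≤ P) (hP0 : 0 ≤ P) (hPI : P < I)
    (hjump : ∀ a, 0 < a → G (α a) + I ≤ G a) (hγ : γ.HasMaxDwell θ) (hc : 0 ≤ c)
    (ht₀ : 0 ≤ t₀) (htt : t₀ ≤ t) :
    W t ≤ c ∨ DecaysBy G (W t) (max c p) (-P) ∨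
      DecaysBy G (W t) (W t₀) (-P) ∧
        DecaysBy G (W t) (W t₀)
          ((I - P) / (θ + 1) * (t - t₀ + (γ.count t₀ t : ℝ)) - I) := by
  have hle : ∀ k : ℕ, (k : ℕ∞) ≤ γ.N := fun k => hγ.1 ▸ le_top
  have hlt_top : ∀ k : ℕ, (k : ℕ∞) < γ.N := fun k => hγ.1 ▸ WithTop.coe_lt_top k
  have hbnd : ∀ {a b}, 0 ≤ a → b - a ≤ θ → ∀ s ∈ Icc a b, -P ≤ ∫ r in s..b, -φ r := by
    intro a b ha hab s hs
    have hs0 : 0 ≤ s := ha.trans hs.1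
    rw [intervalIntegral.integral_neg, neg_le_neg_iff]
    refine le_trans ?_ (hP s hs0)
    rw [← intervalIntegral.integral_add_adjacent_intervals (hint s b hs0 (hs0.trans hs.2))
      (hint b (s + θ) (hs0.trans hs.2) (by positivity))]
    have : 0 ≤ ∫ r in b..s + θ, φ r :=
      intervalIntegral.integral_nonneg (by linarith [hs.1])
        fun r hr => hφ r ((hs0.trans hs.2).trans hr.1)
    linarith
  have hcρ : c ≤ max c p := le_max_left _ _
  have hv₀ : 0 ≤ W t₀ := H.nonneg t₀ ⟨le_rfl, htt⟩
  obtain ⟨k₀, hk₀⟩ := γ.exists_isIndex ht₀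
  obtain ⟨K, hK⟩ := γ.exists_isIndex (ht₀.trans htt)
  have hk₀K := hk₀.mono hK htt
  -- the value reached by a flow and a jump
  have hstep : ∀ (k : ℕ) (a : ℝ), γ.τ k ≤ a → t₀ ≤ a → a < γ.τ (k + 1) → γ.τ (k + 1) ≤ t →
      W (γ.τ (k + 1)) ≤ max c p ∨ DecaysBy G (W (γ.τ (k + 1))) (max (W a) c) (I - P) := by
    intro k a hka hta hlt hkt
    have hf := H.flow_left k a (hlt_top k) hka hta hlt hkt
    have hL := H.left_nonneg (k + 1) (by omega) (hle _) (hta.trans_lt hlt) hkt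
    rcases le_or_gt (L (k + 1)) c with hLc | hLc
    · refine Or.inl ((H.jump (k + 1) (by omega) (hle _) (hta.trans_lt hlt) hkt).trans
        (max_le_max_right p ?_))
      rcases hL.eq_or_lt with hL0 | hL0
      · rwa [← hL0, hα0.1]
      · refine le_trans ((hG.le_iff_le (hα0.2 _ hL0) hL0).1 ?_) hLc
        linarith [hjump _ hL0]
    · have hL0 : 0 < L (k + 1) := hc.trans_lt hLc
      have hd : DecaysBy G (W (γ.τ (k + 1))) (L (k + 1)) I :=
        DecaysBy.mono_left hG (w := α (L (k + 1))) (Or.inr ⟨hα0.2 _ hL0, hL0, hjump _ hL0⟩)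
          (H.jump_of_le (k + 1) (by omega) (hle _) (hta.trans_lt hlt) hkt hLc.le)
      rcases hf.decaysBy_of_le hG (hbnd (ht₀.trans hta) (by linarith [hγ.2 k])) with h | h
      · exact absurd h hLc.not_ge
      · exact Or.inr (hd.trans h)
  -- the value after a jump, relative to the initial one
  have hnext : ∀ (a w j : ℝ), W a ≤ max c p ∨ DecaysBy G (W a) (W t₀) j → ∀ b, 0 ≤ b →
      DecaysBy G w (max (W a) c) b → w ≤ max c p ∨ DecaysBy G w (W t₀) (b + j) := by
    intro a w j ha b hb hd
    rcases ha with h | h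
    · exact Or.inl (hd.le hG hb (hc.trans (le_max_right _ _)) |>.trans (max_le h hcρ))
    · rcases le_total (W a) c with hac | hac
      · rw [max_eq_right hac] at hd
        exact Or.inl ((hd.le hG hb hc).trans hcρ)
      · rw [max_eq_left hac] at hd
        exact Or.inr (hd.trans h)
  have hpost : ∀ k : ℕ, k₀ + 1 ≤ k → k ≤ K → W (γ.τ k) ≤ max c p ∨
      DecaysBy G (W (γ.τ k)) (W t₀) ((I - P) * ((k : ℝ) - k₀)) := by
    intro k hk
    have hIP : 0 ≤ I - P := by linarith
    induction k, hk using Nat.le_induction with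
    | base =>
      intro hkK
      have hτt : γ.τ (k₀ + 1) ≤ t := (γ.τ_mono hkK hK.le_N).trans hK.τ_le
      rcases hstep k₀ t₀ hk₀.τ_le le_rfl (hk₀.lt_τ (hle _) k₀.lt_succ_self) hτt with h | h
      · exact Or.inl h
      · refine (hnext t₀ _ 0 ?_ _ hIP h).imp_right fun h => h.weaken (by push_cast; linarith)
        rcases hv₀.eq_or_lt with h0 | h0
        · exact Or.inr (Or.inl h0.ge)
        · exact Or.inr (Or.inr ⟨h0, h0, by linarith⟩)
    | succ k hk ih =>
      intro hkK
      have hτt : γ.τ (k + 1) ≤ t := (γ.τ_mono hkK hK.le_N).trans hK.τ_le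
      rcases hstep k (γ.τ k) le_rfl (hk₀.lt_τ (hle _) hk).le (γ.τ_lt k (hlt_top k)) hτt with h | h
      · exact Or.inl h
      · exact (hnext _ _ _ (ih (by omega)) _ hIP h).imp_right
          fun h => h.weaken (by push_cast; linarith)
  -- the final flow
  have hfinal : ∀ (a j : ℝ), 0 ≤ j → t - a ≤ θ → γ.τ K ≤ a → t₀ ≤ a → a ≤ t →
      (W a ≤ max c p ∨ DecaysBy G (W a) (W t₀) j) →
      W t ≤ c ∨ DecaysBy G (W t) (max c p) (-P) ∨
        DecaysBy G (W t) (W t₀) (-P) ∧ DecaysBy G (W t) (W t₀) (j - P) := by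
    intro a j hj hat hKa hta ha h
    have hf := H.flow K a t (hle K) hKa hta ha le_rfl hK.lt_next
    rcases hf.decaysBy_of_le hG (hbnd (ht₀.trans hta) hat) with h' | h'
    · exact Or.inl h'
    rcases h with h | h
    · exact Or.inr (Or.inl (h'.mono_right hG (max_le h hcρ)))
    rcases le_total (W a) c with hac | hac
    · rw [max_eq_right hac] at h'
      exact Or.inr (Or.inl (h'.mono_right hG hcρ))
    · rw [max_eq_left hac] at h'
      have := h'.trans h
      exact Or.inr (Or.inr ⟨this.weaken (by linarith), this.weaken (by linarith)⟩)
  have hlast : t - γ.τ K ≤ θ := by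
    have h1 := hK.lt_next
    rw [γ.next_of_lt (hlt_top K)] at h1
    have h2 : t < γ.τ (K + 1) := by exact_mod_cast h1
    linarith [hγ.2 K]
  have htime : t - t₀ + ((K - k₀ : ℕ) : ℝ) ≤ (θ + 1) * (((K - k₀ : ℕ) : ℝ) + 1) := by
    have h1 : ∀ j : ℕ, γ.τ (k₀ + j) - γ.τ k₀ ≤ j * θ := by
      intro j
      induction j with
      | zero => simp
      | succ j ih =>
        have := hγ.2 (k₀ + j)
        rw [← Nat.add_assoc]
        push_cast
        linarith
    have h2 := h1 (K - k₀)
    rw [Nat.add_sub_cancel' hk₀K] at h2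
    linarith [hk₀.τ_le]
  rw [hk₀.count_eq hK]
  have hrate : (I - P) / (θ + 1) * (t - t₀ + ((K - k₀ : ℕ) : ℝ)) - I ≤
      (I - P) * ((K - k₀ : ℕ) : ℝ) - P := by
    have h1 : 0 ≤ (I - P) / (θ + 1) := div_nonneg (by linarith) (by linarith)
    have h2 := mul_le_mul_of_nonneg_left htime h1
    have h3 : (I - P) / (θ + 1) * ((θ + 1) * (((K - k₀ : ℕ) : ℝ) + 1)) =
        (I - P) * (((K - k₀ : ℕ) : ℝ) + 1) := by
      field_simp
    linarith
  have hj0 : 0 ≤ (I - P) * ((K - k₀ : ℕ) : ℝ) := mul_nonneg (by linarith) (Nat.cast_nonneg _)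
  have hmain : ∃ a, t - a ≤ θ ∧ γ.τ K ≤ a ∧ t₀ ≤ a ∧ a ≤ t ∧
      (W a ≤ max c p ∨ DecaysBy G (W a) (W t₀) ((I - P) * ((K - k₀ : ℕ) : ℝ))) := by
    rcases hk₀K.eq_or_lt with rfl | hlt
    · refine ⟨t₀, by linarith [hk₀.τ_le], hk₀.τ_le, le_rfl, htt, Or.inr ?_⟩
      rcases hv₀.eq_or_lt with h0 | h0
      · exact Or.inl h0.ge
      · exact Or.inr ⟨h0, h0, by simp⟩
    · refine ⟨γ.τ K, hlast, le_rfl, (hk₀.lt_τ (hle _) hlt).le, hK.τ_le, ?_⟩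
      rw [Nat.cast_sub hlt.le]
      exact hpost K hlt le_rfl
  obtain ⟨a, h1, h2, h3, h4, h5⟩ := hmain
  exact (hfinal a _ hj0 h1 h2 h3 h4 h5).imp_right
    (Or.imp_right fun h => ⟨h.1, h.2.weaken hrate⟩)

/-! ### Estimates along solutions -/

section InputNorm

variable {m : ℕ} {γ : ImpulseSeq} {u : ℝ → EuclideanSpace ℝ (Fin m)} {t₀ t : ℝ}

lemma inputNorm_ne_top (hu : IsInput u) (ht₀ : 0 ≤ t₀) (ht : 0 ≤ t) :
    inputNorm γ u (Ioc t₀ t) ≠ ⊤ := by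
  refine (max_lt ?_ ?_).ne
  · obtain ⟨C, hC⟩ := hu.2 t
    have hsub : Ioc t₀ t ⊆ Icc 0 t := fun s hs => ⟨ht₀.trans hs.1.le, hs.2⟩
    refine lt_of_le_of_lt (essSup_le_of_ae_le (ENNReal.ofReal C) ?_) ENNReal.ofReal_lt_top
    filter_upwards [ae_restrict_of_ae_restrict_of_subset hsub hC] with s hs
    rw [← ofReal_norm]
    exact ENNReal.ofReal_le_ofReal hs
  · obtain ⟨C, hC⟩ := ((γ.finite_times_inter_Ioc ht₀ ht).image fun s => ‖u s‖).bddAbove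
    refine lt_of_le_of_lt (iSup₂_le fun s hs => ?_) (ENNReal.ofReal_lt_top (r := C))
    rw [← ofReal_norm]
    exact ENNReal.ofReal_le_ofReal (hC ⟨s, hs, rfl⟩)

lemma ae_norm_le_inputNorm (hu : IsInput u) (ht₀ : 0 ≤ t₀) (ht : 0 ≤ t) :
    ∀ᵐ s ∂volume.restrict (Ioc t₀ t), ‖u s‖ ≤ (inputNorm γ u (Ioc t₀ t)).toReal := by
  filter_upwards [ENNReal.ae_le_essSup (μ := volume.restrict (Ioc t₀ t)) fun s => ‖u s‖ₑ] with s hs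
  rw [← toReal_enorm]
  exact ENNReal.toReal_mono (inputNorm_ne_top hu ht₀ ht) (hs.trans (le_max_left _ _))

lemma norm_le_inputNorm (hu : IsInput u) (ht₀ : 0 ≤ t₀) (ht : 0 ≤ t) {s : ℝ} (hs : s ∈ γ.times)
    (hst : s ∈ Ioc t₀ t) : ‖u s‖ ≤ (inputNorm γ u (Ioc t₀ t)).toReal := by
  rw [← toReal_enorm]
  exact ENNReal.toReal_mono (inputNorm_ne_top hu ht₀ ht)
    ((le_iSup₂ (f := fun s (_ : s ∈ γ.times ∩ Ioc t₀ t) => ‖u s‖ₑ) s ⟨hs, hst⟩).trans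
      (le_max_right _ _))

end InputNorm

section Solution

variable {n m : ℕ} {S : ImpulsiveSystem n m} {V : ℝ → EuclideanSpace ℝ (Fin n) → ℝ}
  {g ψ χ : ℝ → ℝ} {t₀ : ℝ} {x₀ : EuclideanSpace ℝ (Fin n)}
  {u : ℝ → EuclideanSpace ℝ (Fin m)} {T : EReal} {x : ℝ → EuclideanSpace ℝ (Fin n)}

lemma ImpulsiveSystem.IsSolution.flowBound (hx : S.IsSolution t₀ x₀ u T x) (ht₀ : 0 ≤ t₀)
    (hV : IsClassV S.γ V) (hg : ContinuousOn g (Ici 0)) (hpos : ∀ r, 0 < r → 0 < g r)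
    (hψ : ∀ a b, 0 ≤ a → 0 ≤ b → IntervalIntegrable ψ volume a b) (hχ : IsKInf χ)
    (hzero : (∀ r, 0 ≤ r → 0 ≤ ψ r) ∨
      ∀ C, ∃ ε, 0 < ε ∧ ∀ w, 0 < w → w ≤ ε → recipPrimitive g w < C)
    (hdini : ∀ t, 0 ≤ t → ∀ ξ μ, t ∉ S.γ.times → χ ‖μ‖ ≤ V t ξ →
      upperDini S.f V t ξ μ ≤ ((-(ψ t * g (V t ξ)) : ℝ) : EReal))
    {k : ℕ} (hk : (k : ℕ∞) ≤ S.γ.N) {a b r w : ℝ} (hka : S.γ.τ k ≤ a) (ha : t₀ ≤ a) (hab : a < b)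
    (hbk : (b : EReal) ≤ S.γ.next k) (hbT : (b : EReal) ≤ T) (hr : 0 ≤ r)
    (hu : ∀ᵐ s, s ∈ Ioo a b → ‖u s‖ ≤ r)
    (hw : Tendsto (fun s => V s (x s)) (𝓝[<] b) (𝓝 w)) :
    FlowBound (recipPrimitive g) ψ (fun s => V s (x s)) (χ r) a b w := by
  have ha0 : 0 ≤ a := ht₀.trans ha
  have hc : 0 ≤ χ r := hχ.isGain.nonneg hr
  have hsnext : ∀ s, s < b → (s : EReal) < S.γ.next k := fun s hs =>
    (EReal.coe_lt_coe_iff.2 hs).trans_le hbk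
  have hno : ∀ s ∈ Ioo a b, s ∉ S.γ.times := fun s hs =>
    ImpulseSeq.notMem_times hk (hka.trans_lt hs.1) (hsnext s hs.2)
  obtain ⟨hAC, hflow⟩ := hx.flow a b ha hab hbT hno
  rw [ae_restrict_iff' measurableSet_Ico] at hflow
  set D : Set (ℝ × EuclideanSpace ℝ (Fin n)) :=
    {p | S.γ.τ k ≤ p.1 ∧ (p.1 : EReal) < S.γ.next k}
  have hlip : LocallyLipschitzOn D (fun p => V p.1 p.2) := hV.1 k hk
  have hmem : ∀ s ∈ Ico a b, (s, x s) ∈ D := fun s hs => ⟨hka.trans hs.1, hsnext s hs.2⟩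
  -- `V` along the solution is absolutely continuous
  have hWAC : ∀ s₁ s₂, a ≤ s₁ → s₁ ≤ s₂ → s₂ < b → a < s₂ →
      AbsolutelyContinuousOnInterval (fun s => V s (x s)) s₁ s₂ := by
    intro s₁ s₂ h1 h12 h2 ha2
    have hx12 : AbsolutelyContinuousOnInterval x s₁ s₂ := (hAC s₂ ⟨ha2, h2⟩).mono
      (uIcc_subset_uIcc (by rw [uIcc_of_le ha2.le]; exact ⟨h1, h12⟩) right_mem_uIcc)
    have hid : AbsolutelyContinuousOnInterval (fun s : ℝ => s) s₁ s₂ :=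
      (LipschitzWith.id.lipschitzOnWith (s := uIcc s₁ s₂)).absolutelyContinuousOnInterval
    have hp := hid.prodMk hx12
    obtain ⟨K, hK⟩ := LocallyLipschitzOn.exists_lipschitzOnWith_of_compact
      (isCompact_uIcc.image_of_continuousOn hp.continuousOn)
      (hlip.mono (by
        rintro _ ⟨s, hs, rfl⟩
        rw [uIcc_of_le h12] at hs
        exact hmem s ⟨h1.trans hs.1, hs.2.trans_lt h2⟩))
    exact hp.comp_lipschitzOnWith hK fun s hs => ⟨s, hs, rfl⟩
  have hWc : ContinuousOn (fun s => V s (x s)) (Ico a b) := by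
    intro s hs
    obtain ⟨d, hsd, hdb⟩ := exists_between hs.2
    have h1 := (hWAC a d le_rfl (hs.1.trans hsd.le) hdb (hs.1.trans_lt hsd)).continuousOn
    rw [uIcc_of_le (hs.1.trans hsd.le)] at h1
    refine (h1 s ⟨hs.1, hsd.le⟩).mono_of_mem_nhdsWithin ?_
    filter_upwards [self_mem_nhdsWithin, mem_nhdsWithin_of_mem_nhds (gt_mem_nhds hsd)] with y hy hyd
    exact ⟨hy.1, hyd.le⟩
  refine flowBound_of_tendsto hab hc (strictMonoOn_recipPrimitive hg hpos)
    (continuousOn_recipPrimitive hg hpos) (hψ a b ha0 (ha0.trans hab.le))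
    (hzero.imp_left fun h r hr => h r (ha0.trans hr.1)) hWc hw ?_
  intro s₁ s₂ h1 h12 h2 habove
  refine recipPrimitive_add_integral_le h12 hg hpos
    (hψ s₁ s₂ (ha0.trans h1.le) (ha0.trans (h1.le.trans h12)))
    (hWAC s₁ s₂ h1.le h12 h2 (h1.trans_le h12)) (fun s hs => hc.trans_lt (habove s hs)) ?_
  filter_upwards [hflow, hu] with s hs hus hs12 hdiff
  have hsI : s ∈ Ioo a b := ⟨h1.trans hs12.1, hs12.2.trans h2⟩
  obtain ⟨K, U, hU, hK⟩ := hlip (hmem s ⟨hsI.1.le, hsI.2⟩)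
  refine deriv_le_of_limsup_le hK ?_ (hs ⟨hsI.1.le, hsI.2⟩) hdiff ?_
  · have hopen : {p : ℝ × EuclideanSpace ℝ (Fin n) | (p.1 : EReal) < S.γ.next k} ∈ 𝓝 (s, x s) :=
      (isOpen_lt (continuous_coe_real_ereal.comp continuous_fst) continuous_const).mem_nhds
        (hsnext s hsI.2)
    refine nhdsWithin_le_of_mem ?_ hU
    filter_upwards [self_mem_nhdsWithin, mem_nhdsWithin_of_mem_nhds hopen] with p hp hp'
    exact ⟨hka.trans (hsI.1.le.trans hp), hp'⟩
  · refine hdini s (ha0.trans hsI.1.le) (x s) (u s) (hno s hsI) ?_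
    exact (hχ.isGain.mono (norm_nonneg (u s)) hr (hus hsI)).trans
      (habove s ⟨hs12.1.le, hs12.2.le⟩).le

theorem ImpulsiveSystem.IsSolution.exists_hybridBound {α π : ℝ → ℝ}
    (hx : S.IsSolution t₀ x₀ u T x) (hu : IsInput u) (ht₀ : 0 ≤ t₀)
    (hV : IsClassV S.γ V) (hVnn : ∀ t, 0 ≤ t → ∀ ξ, 0 ≤ V t ξ)
    (hg : ContinuousOn g (Ici 0)) (hpos : ∀ r, 0 < r → 0 < g r)
    (hψ : ∀ a b, 0 ≤ a → 0 ≤ b → IntervalIntegrable ψ volume a b) (hχ : IsKInf χ) (hπ : IsKInf π)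
    (hzero : (∀ r, 0 ≤ r → 0 ≤ ψ r) ∨
      ∀ C, ∃ ε, 0 < ε ∧ ∀ w, 0 < w → w ≤ ε → recipPrimitive g w < C)
    (hdini : ∀ t, 0 ≤ t → ∀ ξ μ, t ∉ S.γ.times → χ ‖μ‖ ≤ V t ξ →
      upperDini S.f V t ξ μ ≤ ((-(ψ t * g (V t ξ)) : ℝ) : EReal))
    (hjump : ∀ t, 0 ≤ t → ∀ ξ μ, t ∈ S.γ.times → χ ‖μ‖ ≤ leftVal V t ξ →
      V t (ξ + S.g t ξ μ) ≤ α (leftVal V t ξ))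
    (hjump' : ∀ t, 0 ≤ t → ∀ ξ μ, t ∈ S.γ.times → leftVal V t ξ ≤ χ ‖μ‖ →
      V t (ξ + S.g t ξ μ) ≤ π ‖μ‖)
    {t : ℝ} (htt : t₀ ≤ t) (htT : (t : EReal) < T) :
    ∃ L, HybridBound S.γ (recipPrimitive g) ψ α (fun s => V s (x s)) L t₀ t
      (χ (inputNorm S.γ u (Ioc t₀ t)).toReal) (π (inputNorm S.γ u (Ioc t₀ t)).toReal) := by
  have ht : 0 ≤ t := ht₀.trans htt
  set r := (inputNorm S.γ u (Ioc t₀ t)).toReal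
  have hr : 0 ≤ r := ENNReal.toReal_nonneg
  have hur : ∀ᵐ s, s ∈ Ioc t₀ t → ‖u s‖ ≤ r :=
    (ae_restrict_iff' measurableSet_Ioc).1 (ae_norm_le_inputNorm hu ht₀ ht)
  have hT : ∀ s, s ≤ t → (s : EReal) < T := fun s hs => (EReal.coe_le_coe_iff.2 hs).trans_lt htT
  have hL : ∀ k : ℕ, ∃ y : ℝ, 1 ≤ k → (k : ℕ∞) ≤ S.γ.N → t₀ < S.γ.τ k → S.γ.τ k ≤ t →
      Tendsto (fun s => V s (x s)) (𝓝[<] S.γ.τ k) (𝓝 y) ∧ 0 ≤ y ∧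
      V (S.γ.τ k) (x (S.γ.τ k)) ≤ max (α y) (π r) ∧
      (χ r ≤ y → V (S.γ.τ k) (x (S.γ.τ k)) ≤ α y) := by
    intro k
    by_cases hk : 1 ≤ k ∧ (k : ℕ∞) ≤ S.γ.N ∧ t₀ < S.γ.τ k ∧ S.γ.τ k ≤ t
    swap
    · exact ⟨0, fun h1 h2 h3 h4 => absurd ⟨h1, h2, h3, h4⟩ hk⟩
    obtain ⟨h1, h2, h3, h4⟩ := hk
    have hmem : S.γ.τ k ∈ S.γ.times := ⟨k, h1, h2, rfl⟩
    have hτ0 : 0 ≤ S.γ.τ k := ht₀.trans h3.le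
    obtain ⟨xl, hxl, hxj⟩ := hx.jump _ hmem h3 (hT _ h4)
    refine ⟨leftVal V (S.γ.τ k) xl, fun _ _ _ _ => ?_⟩
    have hlim : Tendsto (fun s => V s (x s)) (𝓝[<] S.γ.τ k) (𝓝 (leftVal V (S.γ.τ k) xl)) :=
      (hV.2 _ hmem xl).comp (tendsto_id.prodMk hxl)
    have hunorm : ‖u (S.γ.τ k)‖ ≤ r := norm_le_inputNorm hu ht₀ ht hmem ⟨h3, h4⟩
    refine ⟨hlim, ge_of_tendsto hlim ?_, ?_, fun hle => ?_⟩
    · filter_upwards [Ioo_mem_nhdsLT h3] with s hs using hVnn s (ht₀.trans hs.1.le) _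
    · rw [hxj]
      rcases le_total (χ ‖u (S.γ.τ k)‖) (leftVal V (S.γ.τ k) xl) with h | h
      · exact (hjump _ hτ0 _ _ hmem h).trans (le_max_left _ _)
      · exact ((hjump' _ hτ0 _ _ hmem h).trans
          (hπ.isGain.mono (norm_nonneg _) hr hunorm)).trans (le_max_right _ _)
    · rw [hxj]
      exact hjump _ hτ0 _ _ hmem ((hχ.isGain.mono (norm_nonneg _) hr hunorm).trans hle)
  choose L hL using hL
  refine ⟨L, ⟨fun s hs => hVnn s (ht₀.trans hs.1) _, fun k h1 h2 h3 h4 => (hL k h1 h2 h3 h4).2.1,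
    ?_, ?_, fun k h1 h2 h3 h4 => (hL k h1 h2 h3 h4).2.2.1,
    fun k h1 h2 h3 h4 => (hL k h1 h2 h3 h4).2.2.2⟩⟩
  · intro k a b hk hka ha hab hbt hbk
    rcases hab.eq_or_lt with rfl | hab
    · rcases le_or_gt (V a (x a)) (χ r) with h | h
      · exact Or.inl h
      · exact Or.inr ⟨a, ⟨le_rfl, le_rfl⟩, Or.inl rfl, (hχ.isGain.nonneg hr).trans_lt h, by simp⟩
    obtain ⟨d, hbd, hd⟩ := EReal.lt_iff_exists_real_btwn.1 (lt_min hbk (hT b hbt))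
    rw [lt_min_iff] at hd
    have hbd : b < d := by exact_mod_cast hbd
    have hxAC := (hx.flow a d ha (hab.trans hbd) hd.2.le fun s hs =>
      ImpulseSeq.notMem_times hk (hka.trans_lt hs.1)
        ((EReal.coe_lt_coe_iff.2 hs.2).trans hd.1)).1 b ⟨hab, hbd⟩
    have hxb : Tendsto x (𝓝[<] b) (𝓝 (x b)) := by
      have h1 := hxAC.continuousOn b right_mem_uIcc
      rw [uIcc_of_le hab.le] at h1
      rw [← nhdsWithin_Ioo_eq_nhdsLT hab]
      exact h1.mono Ioo_subset_Icc_self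
    have hW : Tendsto (fun s => V s (x s)) (𝓝[<] b) (𝓝 (V b (x b))) := by
      have h1 := (hV.1 k hk).continuousOn (b, x b) ⟨hka.trans hab.le, hbk⟩
      refine h1.tendsto.comp (tendsto_nhdsWithin_iff.2 ⟨?_, ?_⟩ :
        Tendsto (fun s => (s, x s)) (𝓝[<] b) _)
      · exact (tendsto_id.mono_left nhdsWithin_le_nhds).prodMk_nhds hxb
      · filter_upwards [Ioo_mem_nhdsLT hab] with s hs
        exact ⟨hka.trans hs.1.le, (EReal.coe_lt_coe_iff.2 hs.2).trans hbk⟩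
    refine hx.flowBound ht₀ hV hg hpos hψ hχ hzero hdini hk hka ha hab hbk.le (hT b hbt).le hr ?_ hW
    filter_upwards [hur] with s hs hsab
    exact hs ⟨ha.trans_lt hsab.1, hsab.2.le.trans hbt⟩
  · intro k a hk hka ha hlt hkt
    have hk1 := S.γ.succ_le_of_lt hk
    refine hx.flowBound ht₀ hV hg hpos hψ hχ hzero hdini hk.le hka ha hlt (S.γ.next_of_lt hk).ge
      (hT _ hkt).le hr ?_ (hL (k + 1) (by omega) hk1 (ha.trans_lt hlt) hkt).1
    filter_upwards [hur] with s hs hsab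
    exact hs ⟨ha.trans_lt hsab.1, hsab.2.le.trans hkt⟩

end Solution

theorem theorem4 {n m : ℕ} {Λ : Type*} (Sys : Λ → ImpulsiveSystem n m)
    (ho h : ℝ → EuclideanSpace ℝ (Fin n) → ℝ) (hho : IsMeasuringFun ho) (hh : IsMeasuringFun h)
    (φ φbar αbar : ℝ → ℝ)
    (hφ_nonneg : ∀ t, 0 ≤ t → 0 ≤ φ t) (hφ_int : LocallyIntegrableOn φ (Ici 0) volume)
    (hφbar_cont : ContinuousOn φbar (Ici 0))
    (hαbar_cont : ContinuousOn αbar (Ici 0)) (hαbar_pos : IsPosDefFun αbar)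
    (hLyap : LyapunovAssumption Sys ho h (fun _ t r => φ t * φbar r) (fun _ _ r => αbar r))
    (hcond :
      -- minimum dwell time
      (IsPosDefFun φbar ∧ ∃ θ : ℝ, 0 < θ ∧ (∀ l, (Sys l).γ.HasMinDwell θ) ∧
        (⨆ a ∈ Ioi (0 : ℝ), ((∫ s in a..αbar a, 1 / φbar s : ℝ) : EReal)) <
          (⨅ t ∈ Ici (0 : ℝ), ((∫ s in t..(t + θ), φ s : ℝ) : EReal)) ∧
        0 < (⨅ t ∈ Ici (0 : ℝ), ((∫ s in t..(t + θ), φ s : ℝ) : EReal))) ∨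
      -- maximum dwell time
      (IsPosDefFun (fun r => -φbar r) ∧ ∃ θ : ℝ, 0 < θ ∧ (∀ l, (Sys l).γ.HasMaxDwell θ) ∧
        (∫⁻ s in Ioi (1 : ℝ), ENNReal.ofReal (1 / -φbar s)) = ⊤ ∧
        (⨆ t ∈ Ici (0 : ℝ), ((∫ s in t..(t + θ), φ s : ℝ) : EReal)) <
          (⨅ a ∈ Ioi (0 : ℝ), ((∫ s in αbar a..a, 1 / -φbar s : ℝ) : EReal)))) :
    StronglyISS Sys ho h := by
  obtain ⟨-, -, V, hV, ⟨φ₁, φ₂, hφ₁, hφ₂, hVle⟩, χ, π, hχ, hπ, hdyn⟩ := hLyap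
  have hint : ∀ a b, 0 ≤ a → 0 ≤ b → IntervalIntegrable φ volume a b := fun a b ha hb =>
    (hφ_int.integrableOn_compact_subset (fun s hs => (le_min ha hb).trans hs.1)
      isCompact_uIcc).intervalIntegrable
  have hVnn : ∀ l t, 0 ≤ t → ∀ ξ, 0 ≤ V l t ξ := fun l t ht ξ =>
    (hφ₁.isGain.nonneg (hh t ht ξ)).trans (hVle l t ht ξ).1
  rcases hcond with ⟨hpd, θ, hθ, hdwell, hlt, hMpos⟩ | ⟨hpd, θ, hθ, hdwell, hdiv, hlt⟩
  · obtain ⟨S, hS, hSM⟩ := EReal.lt_iff_exists_real_btwn.1 (max_lt hlt hMpos)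
    obtain ⟨M, hSM, hM⟩ := EReal.lt_iff_exists_real_btwn.1 hSM
    rw [max_lt_iff] at hS
    have hS0 : 0 < S := by exact_mod_cast hS.2
    have hSM : S < M := by exact_mod_cast hSM
    have hMle : ∀ a, 0 ≤ a → M ≤ ∫ r in a..a + θ, φ r := fun a ha =>
      EReal.coe_le_coe_iff.1 (hM.le.trans (iInf₂_le a ha))
    have hG := strictMonoOn_recipPrimitive hφbar_cont hpd.2
    have hjump : ∀ a, 0 < a → recipPrimitive φbar (αbar a) ≤ recipPrimitive φbar a + S := by
      intro a ha
      have h1 := EReal.coe_le_coe_iff.1 ((le_iSup₂ (f := fun a (_ : a ∈ Ioi (0 : ℝ)) =>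
        ((∫ s in a..αbar a, 1 / φbar s : ℝ) : EReal)) a ha).trans hS.1.le)
      rw [integral_one_div_eq_sub hφbar_cont hpd.2 ha (hαbar_pos.2 a ha)] at h1
      linarith
    have hrun := isGain_runningMax hαbar_cont hαbar_pos.1
    have hρ := hχ.isGain.max ((hrun.comp hχ.isGain).max hπ.isGain)
    have hκ : 0 < min ((M - S) / 4) ((M - S) / 4 / θ) := by
      have := sub_pos.2 hSM
      positivity
    refine stronglyISS_of_decaysBy Sys ho h hho hh V hφ₁ hφ₂ hVle hG
      (IsGain.id.max hrun) (hρ.max (hrun.comp hρ)) hκ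
      (C := min ((M - S) / 4) ((M - S) / 4 / θ) + 2 * M + S) ?_
    intro l t₀ ht₀ x₀ u hu T x hx t htt htT
    obtain ⟨L, hL⟩ := hx.exists_hybridBound hu ht₀ (hV l) (hVnn l) hφbar_cont hpd.2 hint hχ hπ
      (Or.inl hφ_nonneg) (fun t ht ξ μ => (hdyn l t ht ξ μ).1)
      (fun t ht ξ μ => (hdyn l t ht ξ μ).2.1) (fun t ht ξ μ => (hdyn l t ht ξ μ).2.2) htt htT
    have := hL.le_of_minDwell hG hαbar_cont hαbar_pos hθ hφ_nonneg hint hMle hS0.le hSM hjump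
      (hdwell l) (hχ.isGain.nonneg ENNReal.toReal_nonneg) ht₀ htt hκ.le (min_le_left _ _)
      (min_le_right _ _) (le_max_left _ _) ((le_max_right _ _).trans (le_max_right _ _))
      ((le_max_left _ _).trans (le_max_right _ _))
    simpa only [hx.init] using this
  · obtain ⟨P, hP, hPI⟩ := EReal.lt_iff_exists_real_btwn.1 hlt
    obtain ⟨I, hPI, hI⟩ := EReal.lt_iff_exists_real_btwn.1 hPI
    have hPI : P < I := by exact_mod_cast hPI
    have hPle : ∀ a, 0 ≤ a → ∫ r in a..a + θ, φ r ≤ P := fun a ha =>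
      EReal.coe_le_coe_iff.1 ((le_iSup₂ (f := fun a (_ : a ∈ Ici (0 : ℝ)) =>
        ((∫ s in a..a + θ, φ s : ℝ) : EReal)) a ha).trans hP.le)
    have hP0 : 0 ≤ P := (intervalIntegral.integral_nonneg (by linarith)
      fun r hr => hφ_nonneg r hr.1).trans (hPle 0 le_rfl)
    have hg : ContinuousOn (fun r => -φbar r) (Ici 0) := hφbar_cont.neg
    have hG := strictMonoOn_recipPrimitive hg hpd.2
    have hjump : ∀ a, 0 < a → recipPrimitive (fun r => -φbar r) (αbar a) + I ≤
        recipPrimitive (fun r => -φbar r) a := by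
      intro a ha
      have h1 := EReal.coe_le_coe_iff.1 (hI.le.trans (iInf₂_le a ha))
      rw [integral_one_div_eq_sub hg hpd.2 (hαbar_pos.2 a ha) ha] at h1
      linarith
    have htop := exists_lt_recipPrimitive hg hpd.2 hdiv
    have hbot := exists_forall_lt_of_strictMonoOn hG hαbar_pos.2 (hP0.trans_lt hPI) hjump
    have hF := isGain_growthBound hG htop hbot P
    refine stronglyISS_of_decaysBy Sys ho h hho hh V hφ₁ hφ₂ hVle hG hF
      (hχ.isGain.max (hF.comp (hχ.isGain.max hπ.isGain)))
      (div_pos (sub_pos.2 hPI) (by linarith : 0 < θ + 1)) (C := I) ?_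
    intro l t₀ ht₀ x₀ u hu T x hx t htt htT
    obtain ⟨L, hL⟩ := hx.exists_hybridBound (ψ := fun r => -φ r) hu ht₀ (hV l) (hVnn l) hg hpd.2
      (fun a b ha hb => (hint a b ha hb).neg) hχ hπ (Or.inr hbot)
      (fun t ht ξ μ h1 h2 => by simpa only [neg_mul_neg] using (hdyn l t ht ξ μ).1 h1 h2)
      (fun t ht ξ μ => (hdyn l t ht ξ μ).2.1) (fun t ht ξ μ => (hdyn l t ht ξ μ).2.2) htt htT
    have hWnn := hVnn l t (ht₀.trans htt) (x t)
    have := hL.le_of_maxDwell hG hαbar_pos hθ hφ_nonneg hint hPle hP0 hPI hjump (hdwell l)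
      (hχ.isGain.nonneg ENNReal.toReal_nonneg) ht₀ htt
    rw [hx.init] at this
    rcases this with h1 | h1 | ⟨h1, h2⟩
    · exact Or.inl (h1.trans (le_max_left _ _))
    · exact Or.inl ((le_growthBound hG htop hWnn h1).trans (le_max_right _ _))
    · exact Or.inr ⟨le_growthBound hG htop hWnn h1, h2⟩
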